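/- The base theory is $\mathbf{ATR_0^{set}}$, the set-theoretic version of arithmetical transfinite recursion: it has a function symbol for each primitive recursive set function (in the sense of Jensen and Karp), and its axioms are extensionality, regularity, infinity, the defining equations of the function symbols, axiom beta (every well-founded relation on a set has a collapsing function) and countability (every set is countable). A set is admissible if it is transitive, contains $\omega$, and is a model of Kripke–Platek set theory. A prae-dilator consists of an endofunctor $T$ of the category of linear orders with order embeddings and a natural transformation $\operatorname{supp}^T:T\Rightarrow[\cdot]^{<\omega}$ (where $[X]^{<\omega}$ is the set of finite subsets of $X$, and $[f]^{<\omega}(a)=\{f(s)\mid s\in a\}$) such that each $\sigma\in T_X$ lies in the range of $T_{\iota_\sigma}$, where $\iota_\sigma:\operatorname{supp}^T_X(\sigma)\hookrightarrow X$ is the inclusion. It is a dilator if $T_X$ is well-founded for every well-order $X$. All (prae-)dilators are given by primitive recursive set functions with a set parameter $p$. A Bachmann–Howard collapse is a function $\vartheta:T_X\to X$ such that, for all $\sigma,\tau\in T_X$, (i) if $\sigma<_{T_X}\tau$ and $s<_X\vartheta(\tau)$ for all $s\in\operatorname{supp}^T_X(\sigma)$, then $\vartheta(\sigma)<_X\vartheta(\tau)$;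 and (ii) $s<_X\vartheta(\sigma)$ for all $s\in\operatorname{supp}^T_X(\sigma)$. If one exists, the linear order $X$ is a Bachmann–Howard fixed point of $T$. Theorem. The following holds over $\mathbf{ATR_0^{set}}$, i.e. in every model of this theory, for all primitive recursive families of functors with supports: (a) If $T$ is a dilator with parameter $p$ and $\mathbb A$ is an admissible set with $p\in\mathbb A$, then the height $o(\mathbb A)=\mathbb A\cap\operatorname{Ord}$, ordered by $\in$, is a well-founded Bachmann–Howard fixed point of $T$. (b) If every set is an element of an admissible set, then every dilator has a well-founded Bachmann–Howard fixed point. Here admissibility of $\mathbb A$ in a model $M$ may even be understood in the weak sense that $(\mathbb A,\in)$ satisfies every standard instance of the Kripke–Platek axioms. -/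

import Mathlib

universe u

namespace BachmannHoward

/-! ### Primitive recursive set functions and the base theory -/

/-- Function symbols for the primitive recursive set functions of Jensen and Karp (with their
arities). Initial functions: constant `0`, projections, `x ∪ {y}`, and the case distinction
`x` if `u ∈ v`, `y` otherwise. Closure: substitution and the recursion
`F(z, x) = G(⋃ {F(w, x) | w ∈ z}, z, x)`. -/
inductive PRSetFun : ℕ → Type
  | zero {n : ℕ} : PRSetFun n
  | proj {n : ℕ} (i : Fin n) : PRSetFun n
  | adjoin : PRSetFun 2
  | cond : PRSetFun 4
  | comp {m n : ℕ} (g : PRSetFun m) (h : Fin m → PRSetFun n) : PRSetFun n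
  | recur {n : ℕ} (g : PRSetFun (n + 2)) : PRSetFun (n + 1)

/-- Models of primitive recursive set theory with infinity: a membership relation and an
interpretation of all symbols for primitive recursive set functions, subject to extensionality,
regularity (for sets), infinity, and the defining equations of the function symbols.
Two elements of the model are equal as sets iff they are equal. -/
class PRSetModel (M : Type u) where
  mem : M → M → Prop
  fn : {n : ℕ} → PRSetFun n → (Fin n → M) → M
  extensionality : ∀ x y, (∀ z, mem z x ↔ mem z y) → x = y
  regularity : ∀ x, (∃ y, mem y x) → ∃ y, mem y x ∧ ∀ z, mem z x → ¬ mem z y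
  infinity : ∃ w, (∃ e, mem e w ∧ ∀ z, ¬ mem z e) ∧
    ∀ x, mem x w → ∃ y, mem y w ∧ ∀ z, mem z y ↔ (mem z x ∨ z = x)
  fn_zero : ∀ {n : ℕ} (v : Fin n → M) (z : M), ¬ mem z (fn PRSetFun.zero v)
  fn_proj : ∀ {n : ℕ} (i : Fin n) (v : Fin n → M), fn (PRSetFun.proj i) v = v i
  fn_adjoin : ∀ x y z, mem z (fn PRSetFun.adjoin ![x, y]) ↔ (mem z x ∨ z = y)
  fn_cond_pos : ∀ x y s t, mem s t → fn PRSetFun.cond ![x, y, s, t] = x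
  fn_cond_neg : ∀ x y s t, ¬ mem s t → fn PRSetFun.cond ![x, y, s, t] = y
  fn_comp : ∀ {m n : ℕ} (g : PRSetFun m) (h : Fin m → PRSetFun n) (v : Fin n → M),
    fn (PRSetFun.comp g h) v = fn g (fun i => fn (h i) v)
  fn_recur : ∀ {n : ℕ} (g : PRSetFun (n + 2)) (z : M) (v : Fin n → M),
    ∃ c, (∀ t, mem t c ↔ ∃ w, mem w z ∧ mem t (fn (PRSetFun.recur g) (Fin.cons w v))) ∧
      fn (PRSetFun.recur g) (Fin.cons z v) = fn g (Fin.cons c (Fin.cons z v))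

infix:50 " ∈ₛ " => PRSetModel.mem

section Basic

variable {M : Type u} [PRSetModel M]

/-- The empty set. -/
def emp : M := PRSetModel.fn PRSetFun.zero ![]

/-- `x ∪ {y}`. -/
def adj (x y : M) : M := PRSetModel.fn PRSetFun.adjoin ![x, y]

/-- The unordered pair `{x, y}`. -/
def upair (x y : M) : M := adj (adj emp x) y

/-- The Kuratowski pair `⟨x, y⟩ = {{x}, {x, y}}`. -/
def opair (x y : M) : M := upair (upair x x) (upair x y)

def Subset (x y : M) : Prop := ∀ z, z ∈ₛ x → z ∈ₛ y

/-- `f` is (the graph of) a function from `a` to `b`. -/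
def IsFun (f a b : M) : Prop :=
  (∀ p, p ∈ₛ f → ∃ x y, x ∈ₛ a ∧ y ∈ₛ b ∧ p = opair x y) ∧
    ∀ x, x ∈ₛ a → ∃! y, opair x y ∈ₛ f

/-- `f` is an injective function from `a` to `b`. -/
def IsInjFun (f a b : M) : Prop :=
  IsFun f a b ∧ ∀ x x' y, opair x y ∈ₛ f → opair x' y ∈ₛ f → x = x'

def IsTransitive (x : M) : Prop := ∀ y, y ∈ₛ x → Subset y x

/-- Ordinals: hereditarily transitive sets. -/
def IsOrdinal (x : M) : Prop := IsTransitive x ∧ ∀ y, y ∈ₛ x → IsTransitive y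

def IsInductive (w : M) : Prop := emp ∈ₛ w ∧ ∀ x, x ∈ₛ w → adj x x ∈ₛ w

/-- `w` is the ordinal `ω`, i.e. the least inductive set. -/
def IsOmega (w : M) : Prop := IsInductive w ∧ ∀ v, IsInductive v → Subset w v

/-- `a` is finite: it can be injected into a natural number. -/
def IsFinite (a : M) : Prop := ∃ w n f, IsOmega w ∧ n ∈ₛ w ∧ IsInjFun f a n

/-- `a` is countable: it can be injected into `ω`. -/
def IsCountable (a : M) : Prop := ∃ w f, IsOmega w ∧ IsInjFun f a w

/-- The relation with graph `r` is well-founded on `a`: each nonempty subset of `a` has an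
`r`-minimal element. -/
def WellFoundedOn (a r : M) : Prop :=
  ∀ s, Subset s a → (∃ x, x ∈ₛ s) → ∃ x, x ∈ₛ s ∧ ∀ y, y ∈ₛ s → ¬ opair y x ∈ₛ r

/-- `f` is a collapsing function for `r` on `a`: a function with domain `a` such that
`f(x) = {f(y) | y ∈ a, ⟨y, x⟩ ∈ r}` for all `x ∈ a`. -/
def IsCollapsing (f a r : M) : Prop :=
  ∃ b, IsFun f a b ∧ ∀ x c, opair x c ∈ₛ f →
    ∀ t, t ∈ₛ c ↔ ∃ y, y ∈ₛ a ∧ opair y x ∈ₛ r ∧ opair y t ∈ₛ f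

end Basic

/-- Models of the set-theoretic version of arithmetical transfinite recursion: primitive recursive
set theory with infinity, axiom beta, and the axiom of countability. -/
class ATR0SetModel (M : Type u) extends PRSetModel M where
  axiomBeta : ∀ a r : M, WellFoundedOn a r → ∃ f, IsCollapsing f a r
  countability : ∀ a : M, IsCountable a

/-! ### Kripke-Platek set theory and admissible sets -/

/-- Formulas in the language with `∈` and `=`, with variables indexed by natural numbers; bounded
quantifiers are separate symbols. `ball i j φ` stands for `∀ x_i ∈ x_j, φ`. -/
inductive SetFormula
  | mem (i j : ℕ)
  | eq (i j : ℕ)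
  | neg (φ : SetFormula)
  | and (φ ψ : SetFormula)
  | ball (i j : ℕ) (φ : SetFormula)
  | all (i : ℕ) (φ : SetFormula)

/-- `Δ₀`-formulas have no unbounded quantifiers. -/
def SetFormula.IsDelta0 : SetFormula → Prop
  | .mem _ _ => True
  | .eq _ _ => True
  | .neg φ => φ.IsDelta0
  | .and φ ψ => φ.IsDelta0 ∧ ψ.IsDelta0
  | .ball _ _ φ => φ.IsDelta0
  | .all _ _ => False

/-- Satisfaction in the structure `(N, R)` under the assignment `v`. -/
def SetFormula.Sat {N : Type u} (R : N → N → Prop) : SetFormula → (ℕ → N) → Prop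
  | .mem i j, v => R (v i) (v j)
  | .eq i j, v => v i = v j
  | .neg φ, v => ¬ φ.Sat R v
  | .and φ ψ, v => φ.Sat R v ∧ ψ.Sat R v
  | .ball i j φ, v => ∀ a, R a (v j) → φ.Sat R (Function.update v i a)
  | .all i φ, v => ∀ a, φ.Sat R (Function.update v i a)

/-- `(N, R)` is a model of Kripke-Platek set theory. -/
structure ModelsKP {N : Type u} (R : N → N → Prop) : Prop where
  extensionality : ∀ x y, (∀ z, R z x ↔ R z y) → x = y
  foundation : ∀ (φ : SetFormula) (v : ℕ → N),
    (∃ x, φ.Sat R (Function.update v 0 x)) →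
      ∃ x, φ.Sat R (Function.update v 0 x) ∧ ∀ y, R y x → ¬ φ.Sat R (Function.update v 0 y)
  pairing : ∀ x y, ∃ z, R x z ∧ R y z
  union : ∀ x, ∃ t, ∀ y z, R y x → R z y → R z t
  delta0_separation : ∀ φ : SetFormula, φ.IsDelta0 → ∀ (v : ℕ → N) (a : N),
    ∃ b, ∀ x, R x b ↔ (R x a ∧ φ.Sat R (Function.update v 0 x))
  delta0_collection : ∀ φ : SetFormula, φ.IsDelta0 → ∀ (v : ℕ → N) (a : N),
    (∀ x, R x a → ∃ y, φ.Sat R (Function.update (Function.update v 0 x) 1 y)) →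
      ∃ b, ∀ x, R x a → ∃ y, R y b ∧ φ.Sat R (Function.update (Function.update v 0 x) 1 y)

section Dilators

variable {M : Type u} [PRSetModel M]

/-- `A` is an admissible set: a transitive set with `ω ∈ A` such that `(A, ∈)` is a model of
Kripke-Platek set theory. -/
def IsAdmissible (A : M) : Prop :=
  IsTransitive A ∧ (∃ w, IsOmega w ∧ w ∈ₛ A) ∧
    ModelsKP (fun x y : {x : M // x ∈ₛ A} => x.1 ∈ₛ y.1)

/-! ### Linear orders as sets

A linear order is a pair `⟨c, r⟩` of a set `c` and (the graph of) a strict linear order `r`. -/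

/-- `s` is an element of (the underlying set of) the order `X`. -/
def Elem (s X : M) : Prop := ∃ c r, X = opair c r ∧ s ∈ₛ c

/-- `s <_X t`. -/
def Lt (X s t : M) : Prop := ∃ c r, X = opair c r ∧ opair s t ∈ₛ r

def IsLinearOrder (X : M) : Prop :=
  ∃ c r, X = opair c r ∧
    (∀ p, p ∈ₛ r → ∃ s t, s ∈ₛ c ∧ t ∈ₛ c ∧ p = opair s t) ∧
    (∀ s, ¬ opair s s ∈ₛ r) ∧
    (∀ s t q, opair s t ∈ₛ r → opair t q ∈ₛ r → opair s q ∈ₛ r) ∧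
    (∀ s t, s ∈ₛ c → t ∈ₛ c → opair s t ∈ₛ r ∨ s = t ∨ opair t s ∈ₛ r)

/-- Well-founded linear orders. -/
def IsWellOrder (X : M) : Prop :=
  IsLinearOrder X ∧ ∃ c r, X = opair c r ∧ WellFoundedOn c r

/-- `f` is a function between the underlying sets of `X` and `Y`. -/
def IsOrdFun (f X Y : M) : Prop := ∃ c r d s, X = opair c r ∧ Y = opair d s ∧ IsFun f c d

/-- `f : X → Y` is an order embedding. -/
def IsEmbedding (f X Y : M) : Prop :=
  IsOrdFun f X Y ∧
    ∀ x x' y y', opair x y ∈ₛ f → opair x' y' ∈ₛ f → Lt X x x' → Lt Y y y'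

/-- `f` is the identity on the underlying set of `X`. -/
def IsIdentity (f X : M) : Prop := ∀ p, p ∈ₛ f ↔ ∃ x, Elem x X ∧ p = opair x x

/-- `h` is the composition `g ∘ f`. -/
def IsComposition (h g f : M) : Prop :=
  ∀ p, p ∈ₛ h ↔ ∃ x y z, opair x y ∈ₛ f ∧ opair y z ∈ₛ g ∧ p = opair x z

/-- `Y` is the suborder of `X` with underlying set `a`. -/
def IsSuborder (Y a X : M) : Prop :=
  (∀ s, s ∈ₛ a → Elem s X) ∧
    ∃ r, Y = opair a r ∧ ∀ p, p ∈ₛ r ↔ ∃ s t, s ∈ₛ a ∧ t ∈ₛ a ∧ Lt X s t ∧ p = opair s t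

/-! ### Dilators -/

/-- Symbols for a primitive recursive family of functors with supports: objects `T_X` are given by
`obj (u, X)`, morphisms `T_f : T_X → T_Y` by `map (u, X, Y, f)`, and supports `supp_X(σ)` by
`supp (u, X, σ)`, where `u` is the parameter of the family. -/
structure DilatorCode where
  obj : PRSetFun 2
  map : PRSetFun 4
  supp : PRSetFun 3

namespace DilatorCode

/-- The order `T_X`, for parameter `u`. -/
def objAt (T : DilatorCode) (u X : M) : M := PRSetModel.fn T.obj ![u, X]

/-- The function `T_f`, for `f : X → Y` and parameter `u`. -/
def mapAt (T : DilatorCode) (u X Y f : M) : M := PRSetModel.fn T.map ![u, X, Y, f]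

/-- The support `supp_X(σ)`, for parameter `u`. -/
def suppAt (T : DilatorCode) (u X σ : M) : M := PRSetModel.fn T.supp ![u, X, σ]

/-- The member with parameter `u` of the family `T` is a prae-dilator. -/
structure IsPraeDilator (T : DilatorCode) (u : M) : Prop where
  obj_linear : ∀ X, IsLinearOrder X → IsLinearOrder (T.objAt u X)
  map_embedding : ∀ X Y f, IsLinearOrder X → IsLinearOrder Y → IsEmbedding f X Y →
    IsEmbedding (T.mapAt u X Y f) (T.objAt u X) (T.objAt u Y)
  map_id : ∀ X f, IsLinearOrder X → IsIdentity f X →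
    IsIdentity (T.mapAt u X X f) (T.objAt u X)
  map_comp : ∀ X Y Z f g h, IsLinearOrder X → IsLinearOrder Y → IsLinearOrder Z →
    IsEmbedding f X Y → IsEmbedding g Y Z → IsComposition h g f →
    IsComposition (T.mapAt u X Z h) (T.mapAt u Y Z g) (T.mapAt u X Y f)
  supp_finite : ∀ X σ, IsLinearOrder X → Elem σ (T.objAt u X) →
    IsFinite (T.suppAt u X σ) ∧ ∀ x, x ∈ₛ T.suppAt u X σ → Elem x X
  supp_natural : ∀ X Y f σ τ, IsLinearOrder X → IsLinearOrder Y → IsEmbedding f X Y →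
    opair σ τ ∈ₛ T.mapAt u X Y f →
    ∀ y, y ∈ₛ T.suppAt u Y τ ↔ ∃ x, x ∈ₛ T.suppAt u X σ ∧ opair x y ∈ₛ f
  supp_range : ∀ X σ, IsLinearOrder X → Elem σ (T.objAt u X) →
    ∃ Y i, IsSuborder Y (T.suppAt u X σ) X ∧ IsIdentity i Y ∧
      ∃ σ₀, opair σ₀ σ ∈ₛ T.mapAt u Y X i

/-- The member with parameter `u` of the family `T` is a dilator. -/
def IsDilator (T : DilatorCode) (u : M) : Prop :=
  T.IsPraeDilator u ∧ ∀ X, IsWellOrder X → IsWellOrder (T.objAt u X)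

/-- `θ : T_X → X` is a Bachmann-Howard collapse. -/
def IsBHCollapse (T : DilatorCode) (u X θ : M) : Prop :=
  IsOrdFun θ (T.objAt u X) X ∧
    (∀ σ τ α β, opair σ α ∈ₛ θ → opair τ β ∈ₛ θ → Lt (T.objAt u X) σ τ →
      (∀ s, s ∈ₛ T.suppAt u X σ → Lt X s β) → Lt X α β) ∧
    (∀ σ α, opair σ α ∈ₛ θ → ∀ s, s ∈ₛ T.suppAt u X σ → Lt X s α)

/-- The order `X` is a Bachmann-Howard fixed point of `T` (with parameter `u`). -/
def IsBHFixedPoint (T : DilatorCode) (u X : M) : Prop :=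
  IsLinearOrder X ∧ ∃ θ, T.IsBHCollapse u X θ

end DilatorCode

/-- `X` is the height `o(A) = A ∩ Ord` with the order given by `∈`. -/
def IsHeightOrder (X A : M) : Prop :=
  ∃ c r, X = opair c r ∧ (∀ x, x ∈ₛ c ↔ (x ∈ₛ A ∧ IsOrdinal x)) ∧
    ∀ p, p ∈ₛ r ↔ ∃ x y, x ∈ₛ c ∧ y ∈ₛ c ∧ x ∈ₛ y ∧ p = opair x y

end Dilators

end BachmannHoward

namespace BachmannHoward

open PRSetModel

/-! The collapse on o(A) is defined by recursion along T_{o(A)}: ϑ(s) is the least ordinal ξ that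
contains supp(s) and satisfies ϑ(t) < ξ for all t < s with supp(t) ⊆ ξ. Both conditions on a
Bachmann–Howard collapse can be read off from this; the content is that such a ξ exists below o(A).

Existence is shown by induction along T_{o(A)}, which is a well-order because T is a dilator and
o(A) is well-ordered by regularity. Given the values below s, choose a in o(A) with supp(s) ⊆ a, put
b_0 = a, and let b_{n+1} be the least ordinal that contains b_n and all ϑ(t) with t < s and supp(t)
⊆ b_n. Σ₁-collection keeps each b_n, the sequence, and its supremum α inside A. Supports are finite,
so supp(t) ⊆ α implies supp(t) ⊆ b_n for some n, hence ϑ(t) < b_{n+1} ≤ α. Thus α is closed, and a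
least closed ξ exists (`exists_closed`, `exists_val`).

T_{o(A)} need not be a subset of A, so A works with codes (a, σ), where a < o(A) and σ ∈ T_a,
compared in T_{a ∪ b}. Every element of T_{o(A)} has such a code, because its support is finite and
o(A) is a limit. Values of ϑ are witnessed by partial collapses g ∈ A (`PartialCollapse`, `Val`),
and all witnesses agree (`Val.unique`).

Definability enters twice. In M, separation and induction are available for primitive recursive
predicates, with arbitrary set parameters. In A, the Kripke–Platek axioms speak about formulas;
`sigmaOn` shows that A is closed under the primitive recursive functions and that their graphs are
Σ₁ over A, which yields `pr_collection`. That proof is an external induction on function symbols, so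
it uses standard instances of the axioms only. -/

/-- The set `x` if `p` holds, `y` otherwise. -/
noncomputable def cset {M : Type u} (p : Prop) (x y : M) : M := by
  classical exact if p then x else y

theorem cset_pos {M : Type u} {p : Prop} (h : p) (x y : M) : cset p x y = x := by simp [cset, h]

theorem cset_neg {M : Type u} {p : Prop} (h : ¬ p) (x y : M) : cset p x y = y := by simp [cset, h]

/-! ### Primitive recursive terms and predicates, with closure properties found by instance search
-/

section PRCalculus

variable {M : Type u} [PRSetModel M]

/-- Terms built from variables, constants in `B` and primitive recursive function symbols, as
functions of an infinite assignment. -/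
inductive PRTerm (B : M → Prop) : ((ℕ → M) → M) → Prop
  | var (i : ℕ) : PRTerm B (fun v => v i)
  | const (c : M) : B c → PRTerm B (fun _ => c)
  | app {n : ℕ} (F : PRSetFun n) (h : Fin n → (ℕ → M) → M) :
      (∀ i, PRTerm B (h i)) → PRTerm B (fun v => fn F (fun i => h i v))

/-- The function `f` is primitive recursive with parameters in `B`. -/
class PR (B : M → Prop) (f : (ℕ → M) → M) : Prop where
  out : PRTerm B f

/-- The class of all parameters. -/
def Any : M → Prop := fun _ => True

/-- Nested terms collapse to one symbol applied to variables and constants, by concatenating the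
argument lists of all subterms. This form is needed because recursion, and later Σ₁-definability,
apply to symbols rather than to terms. -/
theorem PRTerm.normal {B : M → Prop} {f : (ℕ → M) → M} (h : PRTerm B f) :
    ∃ (n : ℕ) (F : PRSetFun n) (a : Fin n → ℕ ⊕ {c // B c}),
      ∀ v, f v = fn F (fun i => Sum.elim v Subtype.val (a i)) := by
  induction h with
  | var i => exact ⟨1, .proj 0, fun _ => .inl i, fun v => by rw [fn_proj]; rfl⟩
  | const c hc => exact ⟨1, .proj 0, fun _ => .inr ⟨c, hc⟩, fun v => by rw [fn_proj]; rfl⟩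
  | @app m F h _ ih =>
    choose n G a hG using ih
    refine ⟨∑ i, n i, .comp F fun i => .comp (G i) fun j => .proj (finSigmaFinEquiv ⟨i, j⟩),
      fun k => a (finSigmaFinEquiv.symm k).1 (finSigmaFinEquiv.symm k).2, fun v => ?_⟩
    simp only [fn_comp, fn_proj, hG]
    congr 1; funext i; congr 1; funext j
    rw [Equiv.symm_apply_apply]

theorem PRTerm.subst {B : M → Prop} {f : (ℕ → M) → M} (h : PRTerm B f)
    (σ : ℕ → (ℕ → M) → M) (hσ : ∀ k, PRTerm B (σ k)) : PRTerm B (fun v => f (fun k => σ k v)) := by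
  induction h with
  | var i => exact hσ i
  | const c hc => exact .const c hc
  | app F h _ ih => exact .app F (fun i v => h i (fun k => σ k v)) ih

theorem PR.subst {B : M → Prop} {f : (ℕ → M) → M} (h : PR B f)
    (σ : ℕ → (ℕ → M) → M) (hσ : ∀ k, PR B (σ k)) : PR B (fun v => f (fun k => σ k v)) :=
  ⟨h.out.subst σ fun k => (hσ k).out⟩

theorem PR.const {B : M → Prop} {c : M} (hc : B c) : PR B (fun _ => c) := ⟨.const c hc⟩

variable {B : M → Prop}

instance instPRVar (i : ℕ) : PR B (fun v => v i) := ⟨.var i⟩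

instance instPRAny (c : M) : PR Any (fun _ => c) := ⟨.const c trivial⟩

theorem PR.app {n : ℕ} (F : PRSetFun n) (h : Fin n → (ℕ → M) → M) (hh : ∀ i, PR B (h i)) :
    PR B (fun v => fn F (fun i => h i v)) := ⟨.app F h fun i => (hh i).out⟩

theorem PR.comp1 {op : M → M} (h : PR B (fun v => op (v 0))) {f : (ℕ → M) → M} [PR B f] :
    PR B (fun v => op (f v)) := h.subst (fun _ => f) fun _ => inferInstance

theorem PR.comp2 {op : M → M → M} (h : PR B (fun v => op (v 0) (v 1))) {f g : (ℕ → M) → M}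
    [hf : PR B f] [hg : PR B g] : PR B (fun v => op (f v) (g v)) :=
  h.subst (fun | 0 => f | _ => g) fun | 0 => hf | _ + 1 => hg

theorem PR.comp4 {op : M → M → M → M → M} (h : PR B (fun v => op (v 0) (v 1) (v 2) (v 3)))
    {f g k l : (ℕ → M) → M} [hf : PR B f] [hg : PR B g] [hk : PR B k] [hl : PR B l] :
    PR B (fun v => op (f v) (g v) (k v) (l v)) :=
  h.subst (fun | 0 => f | 1 => g | 2 => k | _ => l) fun | 0 => hf | 1 => hg | 2 => hk | _ + 3 => hl

instance instPREmp : PR B (fun _ => (emp : M)) := by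
  have := PR.app (B := B) (PRSetFun.zero (n := 0)) (fun i => i.elim0) (fun i => i.elim0)
  convert this using 2
  unfold emp; congr; funext i; exact i.elim0

instance instPRFn2 (F : PRSetFun 2) {f g : (ℕ → M) → M} [hf : PR B f] [hg : PR B g] :
    PR B (fun v => fn F ![f v, g v]) := by
  convert PR.app (B := B) F ![f, g] (by intro i; fin_cases i; exacts [hf, hg]) using 3 with v
  funext i; fin_cases i <;> rfl

instance instPRFn3 (F : PRSetFun 3) {f g h : (ℕ → M) → M} [hf : PR B f] [hg : PR B g]
    [hh : PR B h] : PR B (fun v => fn F ![f v, g v, h v]) := by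
  convert PR.app (B := B) F ![f, g, h] (by intro i; fin_cases i; exacts [hf, hg, hh]) using 3 with v
  funext i; fin_cases i <;> rfl

instance instPRFn4 (F : PRSetFun 4) {f g h k : (ℕ → M) → M} [hf : PR B f] [hg : PR B g]
    [hh : PR B h] [hk : PR B k] : PR B (fun v => fn F ![f v, g v, h v, k v]) := by
  convert PR.app (B := B) F ![f, g, h, k]
    (by intro i; fin_cases i; exacts [hf, hg, hh, hk]) using 3 with v
  funext i; fin_cases i <;> rfl

/-! ### Basic set operations -/

theorem not_mem_emp (x : M) : ¬ x ∈ₛ emp := fn_zero _ x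

theorem mem_adj {x y z : M} : z ∈ₛ adj x y ↔ z ∈ₛ x ∨ z = y := fn_adjoin x y z

theorem mem_upair {x y z : M} : z ∈ₛ upair x y ↔ z = x ∨ z = y := by
  simp [upair, mem_adj, not_mem_emp]

theorem ext {x y : M} (h : ∀ z, z ∈ₛ x ↔ z ∈ₛ y) : x = y := extensionality x y h

theorem upair_self_inj {x y : M} (h : upair x x = upair y y) : x = y := by
  have : x ∈ₛ upair y y := h ▸ mem_upair.2 (.inl rfl)
  simpa [mem_upair] using this

theorem opair_inj {x y x' y' : M} (h : opair x y = opair x' y') : x = x' ∧ y = y' := by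
  have key : ∀ {x y x' y' : M}, opair x y = opair x' y' → x = x' ∧ (y = y' ∨ y = x) := by
    intro x y x' y' h
    have h1 : upair x x ∈ₛ opair x' y' := h ▸ mem_upair.2 (.inl rfl)
    have h2 : upair x y ∈ₛ opair x' y' := h ▸ mem_upair.2 (.inr rfl)
    have hx : x = x' := by
      rcases mem_upair.1 h1 with h1 | h1
      · exact upair_self_inj h1
      · have : x' ∈ₛ upair x x := h1 ▸ mem_upair.2 (.inl rfl)
        simpa [mem_upair, eq_comm] using this
    subst hx
    refine ⟨rfl, ?_⟩
    have hy : ∀ {a b c : M}, upair a b = upair a c → b = a ∨ b = c := fun h =>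
      mem_upair.1 (h ▸ mem_upair.2 (.inr rfl))
    rcases mem_upair.1 h2 with h2 | h2
    · exact .inr (by simpa using hy h2)
    · exact (hy h2).symm
  obtain ⟨h1, h2⟩ := key h
  obtain ⟨_, h3⟩ := key h.symm
  refine ⟨h1, ?_⟩
  rcases h2 with h2 | h2
  · exact h2
  · rcases h3 with h3 | h3
    · exact h3.symm
    · rw [h2, h3, h1]

theorem mem_irrefl (x : M) : ¬ x ∈ₛ x := by
  intro h
  obtain ⟨y, hy, hy'⟩ := regularity (upair x x) ⟨x, mem_upair.2 (.inl rfl)⟩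
  obtain rfl : y = x := by simpa [mem_upair] using hy
  exact hy' y hy h

theorem mem_asymm {x y : M} (h : x ∈ₛ y) : ¬ y ∈ₛ x := by
  intro h'
  obtain ⟨z, hz, hz'⟩ := regularity (upair x y) ⟨x, mem_upair.2 (.inl rfl)⟩
  rcases mem_upair.1 hz with rfl | rfl
  · exact hz' y (mem_upair.2 (.inr rfl)) h'
  · exact hz' x (mem_upair.2 (.inl rfl)) h

instance instPRAdj {f g : (ℕ → M) → M} [PR B f] [PR B g] : PR B (fun v => adj (f v) (g v)) := by
  unfold adj; infer_instance

instance instPRUpair {f g : (ℕ → M) → M} [PR B f] [PR B g] :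
    PR B (fun v => upair (f v) (g v)) := by
  unfold upair; infer_instance

instance instPROpair {f g : (ℕ → M) → M} [PR B f] [PR B g] :
    PR B (fun v => opair (f v) (g v)) := by
  unfold opair; infer_instance

theorem mem_cset {p : Prop} {x y t : M} :
    t ∈ₛ cset p x y ↔ p ∧ t ∈ₛ x ∨ ¬ p ∧ t ∈ₛ y := by
  by_cases h : p <;> simp [cset, h]

/-- The set `⋃ {H x | x ∈ a}`, if it exists. -/
noncomputable def bU (a : M) (H : M → M) : M := by
  classical exact
    if h : ∃ c, ∀ t, t ∈ₛ c ↔ ∃ x, x ∈ₛ a ∧ t ∈ₛ H x then h.choose else emp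

theorem bU_eq {a c : M} {H : M → M} (h : ∀ t, t ∈ₛ c ↔ ∃ x, x ∈ₛ a ∧ t ∈ₛ H x) : bU a H = c := by
  have h' : ∃ c, ∀ t, t ∈ₛ c ↔ ∃ x, x ∈ₛ a ∧ t ∈ₛ H x := ⟨c, h⟩
  rw [bU, dif_pos h']
  exact ext fun t => (h'.choose_spec t).trans (h t).symm

/-- The recursion scheme only provides unions of previous values, so F must be smuggled in. Let K(z,
d) be F(z) if z ∈ d, and the union of K(w, d) over w ∈ z otherwise. As d ∉ d, the value K(d, d) is
the union of F(w) over w ∈ d. -/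
theorem exists_bU {f : (ℕ → M) → M} {H : (ℕ → M) → M → M} (hf : PR B f)
    (hH : PR B (fun w => H (fun k => w (k + 1)) (w 0))) :
    ∃ g, PR B g ∧ ∀ v t, t ∈ₛ g v ↔ ∃ x, x ∈ₛ f v ∧ t ∈ₛ H v x := by
  classical
  obtain ⟨n, F, a, hF⟩ := hH.out.normal
  have hF' : ∀ v x, H v x = fn F (fun i => Sum.elim (fun k => Nat.casesOn k x v)
      Subtype.val (a i)) := fun v x => hF (fun k => Nat.casesOn k x v)
  -- The step function receives the union of earlier values, z, d and the parameters, in this order.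
  -- The argument places of `F` that read the bound variable are those with `a i = .inl 0`; they are
  -- fed with z.
  let K : PRSetFun (n + 2) := .recur (.comp .cond
    ![.comp F (fun i => if a i = .inl 0 then .proj 1 else .proj i.succ.succ.succ),
      .proj 0, .proj 1, .proj 2])
  have hK : ∀ (z d : M) (u : Fin n → M), ∃ c,
      (∀ t, t ∈ₛ c ↔ ∃ w, w ∈ₛ z ∧ t ∈ₛ fn K (Fin.cons w (Fin.cons d u))) ∧
      fn K (Fin.cons z (Fin.cons d u)) =
        cset (z ∈ₛ d) (fn F (fun i => if a i = .inl 0 then z else u i)) c := by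
    intro z d u
    obtain ⟨c, hc, hc'⟩ := fn_recur (.comp .cond
      ![.comp F (fun i => if a i = .inl 0 then .proj 1 else .proj i.succ.succ.succ),
        .proj 0, .proj 1, .proj 2]) z (Fin.cons d u)
    refine ⟨c, hc, hc'.trans ?_⟩
    rw [fn_comp]
    set V : Fin (n + 3) → M := Fin.cons c (Fin.cons z (Fin.cons d u)) with hV
    have : (fun i => fn ((![.comp F (fun i => if a i = .inl 0 then .proj 1
        else .proj i.succ.succ.succ), .proj 0, .proj 1, .proj 2] : Fin 4 → PRSetFun (n + 3)) i) V) =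
        ![fn F (fun i => if a i = .inl 0 then z else u i), c, z, d] := by
      funext i
      fin_cases i
      · change fn (PRSetFun.comp F _) V = fn F _
        rw [fn_comp]
        congr 1; funext i
        split
        · rw [fn_proj]; rfl
        · rw [fn_proj]; rfl
      · exact fn_proj _ _
      · exact fn_proj _ _
      · exact fn_proj _ _
    rw [this]
    by_cases h : z ∈ₛ d
    · rw [cset_pos h, fn_cond_pos _ _ _ _ h]
    · rw [cset_neg h, fn_cond_neg _ _ _ _ h]
  -- Places that read the bound variable are ignored by `K`; `f v` is a dummy there.
  let U : Fin n → (ℕ → M) → M := fun i v =>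
    match a i with
    | .inl 0 => f v
    | .inl (k + 1) => v k
    | .inr c => c.1
  refine ⟨fun v => fn K (fun i => (Fin.cons f (Fin.cons f U) : Fin (n + 2) → (ℕ → M) → M) i v),
    PR.app _ _ ?_, fun v t => ?_⟩
  · intro i
    refine Fin.cases hf (fun i => Fin.cases hf (fun i => ?_) i) i
    simp only [Fin.cons_succ, U]
    rcases h : a i with (_ | k) | c
    · exact hf
    · infer_instance
    · exact PR.const c.2
  · have : (fun i => (Fin.cons f (Fin.cons f U) : Fin (n + 2) → (ℕ → M) → M) i v) =
        (Fin.cons (f v) (Fin.cons (f v) (fun i => U i v)) : Fin (n + 2) → M) := by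
      funext i
      refine Fin.cases rfl (fun i => Fin.cases rfl (fun i => ?_) i) i
      rfl
    simp only [this]
    obtain ⟨c, hc, hc'⟩ := hK (f v) (f v) (fun i => U i v)
    rw [hc', cset_neg (mem_irrefl _), hc]
    refine exists_congr fun w => and_congr_right fun hw => ?_
    obtain ⟨c, hc, hc'⟩ := hK w (f v) (fun i => U i v)
    rw [hc', cset_pos hw, hF']
    refine iff_of_eq (congrArg _ (congrArg _ (funext fun i => ?_)))
    simp only [U]
    rcases h : a i with (_ | k) | c <;> simp

instance instPRBU {f : (ℕ → M) → M} {H : (ℕ → M) → M → M} [hf : PR B f]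
    [hH : PR B (fun w => H (fun k => w (k + 1)) (w 0))] :
    PR B (fun v => bU (f v) (fun x => H v x)) := by
  obtain ⟨g, hg, h⟩ := exists_bU hf hH
  convert hg using 2 with v
  exact bU_eq (h v)

theorem mem_bU {a t : M} (H : M → M) [hH : PR Any (fun v : ℕ → M => H (v 0))] :
    t ∈ₛ bU a H ↔ ∃ x, x ∈ₛ a ∧ t ∈ₛ H x := by
  obtain ⟨g, -, h⟩ := exists_bU (f := fun _ => a) (H := fun _ => H) (inferInstance) hH
  rw [bU_eq (h fun _ => emp), h]

/-! ### Primitive recursive predicates and bounded quantifiers -/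

instance instPRCondMem {f g s t : (ℕ → M) → M} [PR B f] [PR B g] [PR B s] [PR B t] :
    PR B (fun v => cset (s v ∈ₛ t v) (f v) (g v)) := by
  have : PR B (fun v => fn PRSetFun.cond ![f v, g v, s v, t v]) := inferInstance
  convert this using 2 with v
  by_cases h : s v ∈ₛ t v
  · rw [cset_pos h, fn_cond_pos _ _ _ _ h]
  · rw [cset_neg h, fn_cond_neg _ _ _ _ h]

/-- The predicate `P` is primitive recursive with parameters in `B`. -/
class PRP (B : M → Prop) (P : (ℕ → M) → Prop) : Prop where
  out : PR B (fun v => cset (P v) (upair emp emp) emp)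

instance instPRCset {P : (ℕ → M) → Prop} {f g : (ℕ → M) → M} [hP : PRP B P] [PR B f] [PR B g] :
    PR B (fun v => cset (P v) (f v) (g v)) := by
  have := hP.out
  have : PR B (fun v : ℕ → M => cset ((emp : M) ∈ₛ cset (P v) (upair emp emp) emp) (f v) (g v)) := inferInstance
  convert this using 3 with v
  simp [mem_cset, mem_upair, not_mem_emp]

instance instPRPMem {f g : (ℕ → M) → M} [PR B f] [PR B g] : PRP B (fun v => f v ∈ₛ g v) :=
  ⟨instPRCondMem⟩

theorem PRP.congr {P Q : (ℕ → M) → Prop} (hP : PRP B P) (h : ∀ v, Q v ↔ P v) : PRP B Q := by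
  obtain rfl : Q = P := funext fun v => propext (h v)
  exact hP

instance instPRPEq {f g : (ℕ → M) → M} [PR B f] [PR B g] : PRP B (fun v => f v = g v) :=
  PRP.congr (P := fun v => f v ∈ₛ upair (g v) (g v)) inferInstance fun v => by simp [mem_upair]

instance instPRPNot {P : (ℕ → M) → Prop} [PRP B P] : PRP B (fun v => ¬ P v) := by
  have : PR B (fun v => cset (P v) emp (upair emp emp)) := inferInstance
  refine ⟨?_⟩
  convert this using 2 with v
  by_cases h : P v <;> simp [cset, h]

instance instPRPAnd {P Q : (ℕ → M) → Prop} [hP : PRP B P] [hQ : PRP B Q] :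
    PRP B (fun v => P v ∧ Q v) := by
  have := hQ.out
  have : PR B (fun v => cset (P v) (cset (Q v) (upair emp emp) emp) emp) := inferInstance
  refine ⟨?_⟩
  convert this using 2 with v
  by_cases h : P v <;> by_cases h' : Q v <;> simp [cset, h, h']

instance instPRPOr {P Q : (ℕ → M) → Prop} [PRP B P] [PRP B Q] :
    PRP B (fun v => P v ∨ Q v) :=
  PRP.congr (P := fun v => ¬ (¬ P v ∧ ¬ Q v)) inferInstance fun v => by tauto

instance instPRPImp {P Q : (ℕ → M) → Prop} [PRP B P] [PRP B Q] :
    PRP B (fun v => P v → Q v) :=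
  PRP.congr (P := fun v => ¬ (P v ∧ ¬ Q v)) inferInstance fun v => by tauto

instance instPRPBex {f : (ℕ → M) → M} {P : (ℕ → M) → M → Prop} [hf : PR B f]
    [hP : PRP B (fun w => P (fun k => w (k + 1)) (w 0))] :
    PRP B (fun v => ∃ x, x ∈ₛ f v ∧ P v x) := by
  obtain ⟨g, hg, h⟩ := exists_bU (H := fun v x => cset (P v x) (upair emp emp) emp) hf hP.out
  refine PRP.congr (P := fun v => emp ∈ₛ g v) inferInstance fun v => ?_
  rw [h]
  simp [mem_cset, mem_upair, not_mem_emp]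

instance instPRPBall {f : (ℕ → M) → M} {P : (ℕ → M) → M → Prop} [hf : PR B f]
    [hP : PRP B (fun w => P (fun k => w (k + 1)) (w 0))] :
    PRP B (fun v => ∀ x, x ∈ₛ f v → P v x) :=
  PRP.congr (P := fun v => ¬ ∃ x, x ∈ₛ f v ∧ ¬ P v x) inferInstance fun v => by simp

theorem PRP.subst {P : (ℕ → M) → Prop} (h : PRP B P)
    (σ : ℕ → (ℕ → M) → M) (hσ : ∀ k, PR B (σ k)) : PRP B (fun v => P (fun k => σ k v)) :=
  ⟨h.out.subst σ hσ⟩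

theorem PRP.comp1 {op : M → Prop} (h : PRP B (fun v => op (v 0))) {f : (ℕ → M) → M} [PR B f] :
    PRP B (fun v => op (f v)) := h.subst (fun _ => f) fun _ => inferInstance

theorem PRP.comp2 {op : M → M → Prop} (h : PRP B (fun v => op (v 0) (v 1))) {f g : (ℕ → M) → M}
    [hf : PR B f] [hg : PR B g] : PRP B (fun v => op (f v) (g v)) :=
  h.subst (fun | 0 => f | _ => g) fun | 0 => hf | _ + 1 => hg

theorem PRP.comp4 {op : M → M → M → M → Prop} (h : PRP B (fun v => op (v 0) (v 1) (v 2) (v 3)))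
    {f g k l : (ℕ → M) → M} [hf : PR B f] [hg : PR B g] [hk : PR B k] [hl : PR B l] :
    PRP B (fun v => op (f v) (g v) (k v) (l v)) :=
  h.subst (fun | 0 => f | 1 => g | 2 => k | _ => l) fun | 0 => hf | 1 => hg | 2 => hk | _ + 3 => hl

/-! ### Derived operations and predicates -/

/-- The set `{x ∈ a | P x}`. -/
noncomputable def sep (a : M) (P : M → Prop) : M := bU a fun x => cset (P x) (upair x x) emp

instance instPRSep {f : (ℕ → M) → M} {P : (ℕ → M) → M → Prop} [hf : PR B f]
    [hP : PRP B (fun w => P (fun k => w (k + 1)) (w 0))] :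
    PR B (fun v => sep (f v) (fun x => P v x)) := by
  unfold sep; infer_instance

theorem mem_sep {a t : M} (P : M → Prop) [hP : PRP Any (fun v : ℕ → M => P (v 0))] :
    t ∈ₛ sep a P ↔ t ∈ₛ a ∧ P t := by
  rw [sep, mem_bU]
  simp only [mem_cset, mem_upair, not_mem_emp, and_false, or_false, or_self]
  constructor
  · rintro ⟨x, hx, h, rfl⟩; exact ⟨hx, h⟩
  · rintro ⟨h, h'⟩; exact ⟨t, h, h', rfl⟩

/-- The union of the elements of `a`. -/
noncomputable def sU (a : M) : M := bU a fun x => x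

instance instPRSU {f : (ℕ → M) → M} [PR B f] : PR B (fun v => sU (f v)) := by
  unfold sU; infer_instance

theorem mem_sU {a t : M} : t ∈ₛ sU a ↔ ∃ x, x ∈ₛ a ∧ t ∈ₛ x := by
  rw [sU, mem_bU]

/-- The union of `x` and `y`. -/
noncomputable def un (x y : M) : M := sU (upair x y)

instance instPRUn {f g : (ℕ → M) → M} [PR B f] [PR B g] : PR B (fun v => un (f v) (g v)) := by
  unfold un; infer_instance

theorem mem_un {x y t : M} : t ∈ₛ un x y ↔ t ∈ₛ x ∨ t ∈ₛ y := by
  rw [un, mem_sU]; simp [mem_upair]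

/-- The first component of an ordered pair. -/
noncomputable def fst (p : M) : M := bU (sU p) fun x => cset (∃ y, y ∈ₛ sU p ∧ p = opair x y) x emp

/-- The second component of an ordered pair. -/
noncomputable def snd (p : M) : M := bU (sU p) fun y => cset (∃ x, x ∈ₛ sU p ∧ p = opair x y) y emp

instance instPRFst {f : (ℕ → M) → M} [PR B f] : PR B (fun v => fst (f v)) :=
  PR.comp1 (op := fst) (by unfold fst; infer_instance)

instance instPRSnd {f : (ℕ → M) → M} [PR B f] : PR B (fun v => snd (f v)) :=
  PR.comp1 (op := snd) (by unfold snd; infer_instance)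

theorem left_mem_sU (x y : M) : x ∈ₛ sU (opair x y) :=
  mem_sU.2 ⟨upair x x, mem_upair.2 (.inl rfl), mem_upair.2 (.inl rfl)⟩

theorem right_mem_sU (x y : M) : y ∈ₛ sU (opair x y) :=
  mem_sU.2 ⟨upair x y, mem_upair.2 (.inr rfl), mem_upair.2 (.inr rfl)⟩

@[simp] theorem fst_opair (x y : M) : fst (opair x y) = x := by
  refine bU_eq fun t => ⟨fun h => ⟨x, left_mem_sU x y, ?_⟩, ?_⟩
  · rw [cset_pos ⟨y, right_mem_sU x y, rfl⟩]; exact h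
  · rintro ⟨x', -, h⟩
    rcases mem_cset.1 h with ⟨⟨y', -, h'⟩, h⟩ | ⟨-, h⟩
    · rwa [(opair_inj h').1]
    · exact absurd h (not_mem_emp _)

@[simp] theorem snd_opair (x y : M) : snd (opair x y) = y := by
  refine bU_eq fun t => ⟨fun h => ⟨y, right_mem_sU x y, ?_⟩, ?_⟩
  · rw [cset_pos ⟨x, left_mem_sU x y, rfl⟩]; exact h
  · rintro ⟨x', -, h⟩
    rcases mem_cset.1 h with ⟨⟨y', -, h'⟩, h⟩ | ⟨-, h⟩
    · rwa [(opair_inj h').2]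
    · exact absurd h (not_mem_emp _)

/-- The value of the function with graph `f` at `x`. -/
noncomputable def app (f x : M) : M := bU (sU (sU f)) fun y => cset (opair x y ∈ₛ f) y emp

instance instPRApp {f g : (ℕ → M) → M} [PR B f] [PR B g] : PR B (fun v => app (f v) (g v)) :=
  PR.comp2 (op := app) (by unfold app; infer_instance)

theorem app_eq {f x y : M} (h : opair x y ∈ₛ f) (hu : ∀ y', opair x y' ∈ₛ f → y' = y) :
    app f x = y := by
  refine bU_eq fun t => ⟨fun ht => ⟨y, ?_, ?_⟩, ?_⟩
  · exact mem_sU.2 ⟨_, mem_sU.2 ⟨_, h, mem_upair.2 (.inr rfl)⟩, mem_upair.2 (.inr rfl)⟩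
  · rwa [cset_pos h]
  · rintro ⟨y', -, h'⟩
    rcases mem_cset.1 h' with ⟨h1, h2⟩ | ⟨-, h2⟩
    · rwa [hu y' h1] at h2
    · exact absurd h2 (not_mem_emp _)

theorem IsFun.app_mem {f a b x : M} (hf : IsFun f a b) (hx : x ∈ₛ a) :
    opair x (app f x) ∈ₛ f ∧ app f x ∈ₛ b := by
  obtain ⟨y, hy, hu⟩ := hf.2 x hx
  obtain ⟨x', y', hx', hy', h⟩ := hf.1 _ hy
  rw [app_eq hy hu]
  exact ⟨hy, (opair_inj h).2 ▸ hy'⟩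

theorem IsFun.app_eq {f a b x y : M} (hf : IsFun f a b) (h : opair x y ∈ₛ f) : app f x = y := by
  obtain ⟨x', y', hx', hy', h'⟩ := hf.1 _ h
  obtain rfl := (opair_inj h').1
  exact (hf.2 _ hx').unique (hf.app_mem hx').1 h

instance instPRPSubset {f g : (ℕ → M) → M} [PR B f] [PR B g] :
    PRP B (fun v => Subset (f v) (g v)) :=
  PRP.comp2 (op := Subset) (by unfold Subset; infer_instance)

instance instPRPTransitive {f : (ℕ → M) → M} [PR B f] : PRP B (fun v => IsTransitive (f v)) :=
  PRP.comp1 (op := IsTransitive) (by unfold IsTransitive; infer_instance)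

instance instPRPOrdinal {f : (ℕ → M) → M} [PR B f] : PRP B (fun v => IsOrdinal (f v)) :=
  PRP.comp1 (op := IsOrdinal) (by unfold IsOrdinal; infer_instance)

theorem lt_iff {X s t : M} : Lt X s t ↔ X = opair (fst X) (snd X) ∧ opair s t ∈ₛ snd X := by
  constructor
  · rintro ⟨c, r, rfl, h⟩; simpa using h
  · rintro ⟨h, h'⟩; exact ⟨_, _, h, h'⟩

theorem elem_iff {s X : M} : Elem s X ↔ X = opair (fst X) (snd X) ∧ s ∈ₛ fst X := by
  constructor
  · rintro ⟨c, r, rfl, h⟩; simpa using h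
  · rintro ⟨h, h'⟩; exact ⟨_, _, h, h'⟩

instance instPRPLt {f g h : (ℕ → M) → M} [PR B f] [PR B g] [PR B h] :
    PRP B (fun v => Lt (f v) (g v) (h v)) := by
  simp only [lt_iff]; infer_instance

/-- Regularity concerns sets, so it is applied to a separated subset. This is why every induction
carried out in M needs a primitive recursive predicate. -/
theorem exists_minimal {a : M} (P : M → Prop) [PRP Any (fun v : ℕ → M => P (v 0))]
    (h : ∃ x, x ∈ₛ a ∧ P x) : ∃ x, x ∈ₛ a ∧ P x ∧ ∀ y, y ∈ₛ a → y ∈ₛ x → ¬ P y := by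
  obtain ⟨x, hx, hP⟩ := h
  obtain ⟨y, hy, hy'⟩ := regularity (sep a P) ⟨x, (mem_sep P).2 ⟨hx, hP⟩⟩
  rw [mem_sep P] at hy
  exact ⟨y, hy.1, hy.2, fun z hz hzy hPz => hy' z ((mem_sep P).2 ⟨hz, hPz⟩) hzy⟩

theorem mem_induction {a : M} (ha : IsTransitive a) (P : M → Prop)
    [PRP Any (fun v : ℕ → M => P (v 0))]
    (h : ∀ x, x ∈ₛ a → (∀ y, y ∈ₛ x → P y) → P x) : ∀ x, x ∈ₛ a → P x := by
  intro x hx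
  by_contra hP
  obtain ⟨y, hy, hPy, hmin⟩ := exists_minimal (a := a) (fun x => ¬ P x) ⟨x, hx, hP⟩
  exact hPy (h y hy fun z hz => not_not.1 (hmin z (ha y hy z hz) hz))

theorem wf_induction {a r : M} (ha : WellFoundedOn a r) (P : M → Prop)
    [PRP Any (fun v : ℕ → M => P (v 0))]
    (h : ∀ x, x ∈ₛ a → (∀ y, y ∈ₛ a → opair y x ∈ₛ r → P y) → P x) : ∀ x, x ∈ₛ a → P x := by
  intro x hx
  by_contra hP
  obtain ⟨y, hy, hmin⟩ := ha (sep a fun x => ¬ P x) (fun z hz => ((mem_sep _).1 hz).1)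
    ⟨x, (mem_sep _).2 ⟨hx, hP⟩⟩
  rw [mem_sep] at hy
  refine hy.2 (h y hy.1 fun z hz hzy => ?_)
  by_contra hPz
  exact hmin z ((mem_sep _).2 ⟨hz, hPz⟩) hzy

theorem omega_induction {w : M} (hw : IsOmega w) (P : M → Prop)
    [PRP Any (fun v : ℕ → M => P (v 0))] (h0 : P emp)
    (h : ∀ x, x ∈ₛ w → P x → P (adj x x)) : ∀ x, x ∈ₛ w → P x := by
  intro x hx
  refine ((mem_sep P).1 (hw.2 (sep w P) ⟨(mem_sep P).2 ⟨hw.1.1, h0⟩, fun y hy => ?_⟩ x hx)).2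
  rw [mem_sep] at hy ⊢
  exact ⟨hw.1.2 y hy.1, h y hy.1 hy.2⟩

end PRCalculus

/-! ### `Δ₀`- and `Σ₁`-definability -/

theorem SetFormula.exists_bound {N : Type u} (R : N → N → Prop) (φ : SetFormula) :
    ∃ B : ℕ, ∀ v v' : ℕ → N, (∀ k < B, v k = v' k) → (φ.Sat R v ↔ φ.Sat R v') := by
  induction φ with
  | mem i j =>
    exact ⟨i + j + 1, fun v v' h => by rw [Sat, Sat, h i (by omega), h j (by omega)]⟩
  | eq i j =>
    exact ⟨i + j + 1, fun v v' h => by rw [Sat, Sat, h i (by omega), h j (by omega)]⟩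
  | neg φ ih =>
    obtain ⟨B, hB⟩ := ih
    exact ⟨B, fun v v' h => not_congr (hB v v' h)⟩
  | and φ ψ ih ih' =>
    obtain ⟨B, hB⟩ := ih
    obtain ⟨B', hB'⟩ := ih'
    exact ⟨B + B', fun v v' h => and_congr (hB v v' fun k hk => h k (by omega))
      (hB' v v' fun k hk => h k (by omega))⟩
  | ball i j φ ih =>
    obtain ⟨B, hB⟩ := ih
    refine ⟨B + j + 1, fun v v' h => ?_⟩
    simp only [Sat]
    rw [h j (by omega)]
    refine forall_congr' fun a => imp_congr_right fun _ => hB _ _ fun k hk => ?_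
    simp only [Function.update_apply, h k (by omega)]
  | all i φ ih =>
    obtain ⟨B, hB⟩ := ih
    refine ⟨B, fun v v' h => forall_congr' fun a => hB _ _ fun k hk => ?_⟩
    simp only [Function.update_apply, h k hk]

/-- The renaming `ρ` need not be injective, so capture is avoided by giving each quantifier a
variable above all `ρ k` with k below the bound on relevant variables. -/
theorem SetFormula.exists_rename {N : Type u} (R : N → N → Prop) (φ : SetFormula) (ρ : ℕ → ℕ) :
    ∃ ψ : SetFormula, (φ.IsDelta0 → ψ.IsDelta0) ∧
      ∀ v : ℕ → N, ψ.Sat R v ↔ φ.Sat R (fun k => v (ρ k)) := by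
  have fresh : ∀ (φ : SetFormula) (ρ : ℕ → ℕ) (i : ℕ), ∃ i', ∀ (v : ℕ → N) (a : N),
      φ.Sat R (fun k => Function.update v i' a (Function.update ρ i i' k)) ↔
        φ.Sat R (Function.update (fun k => v (ρ k)) i a) := by
    intro φ ρ i
    obtain ⟨B, hB⟩ := φ.exists_bound R
    refine ⟨(Finset.range B).sup ρ + 1, fun v a => hB _ _ fun k hk => ?_⟩
    by_cases hki : k = i
    · subst hki; simp
    · have : ρ k ≤ (Finset.range B).sup ρ := Finset.le_sup (Finset.mem_range.2 hk)
      simp [hki, show ρ k ≠ (Finset.range B).sup ρ + 1 by omega]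
  induction φ generalizing ρ with
  | mem i j => exact ⟨.mem (ρ i) (ρ j), fun _ => trivial, fun v => Iff.rfl⟩
  | eq i j => exact ⟨.eq (ρ i) (ρ j), fun _ => trivial, fun v => Iff.rfl⟩
  | neg φ ih =>
    obtain ⟨ψ, hψ, h⟩ := ih ρ
    exact ⟨.neg ψ, hψ, fun v => not_congr (h v)⟩
  | and φ φ' ih ih' =>
    obtain ⟨ψ, hψ, h⟩ := ih ρ
    obtain ⟨ψ', hψ', h'⟩ := ih' ρ
    exact ⟨.and ψ ψ', fun H => ⟨hψ H.1, hψ' H.2⟩, fun v => and_congr (h v) (h' v)⟩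
  | ball i j φ ih =>
    obtain ⟨i', hi'⟩ := fresh φ ρ i
    obtain ⟨ψ, hψ, h⟩ := ih (Function.update ρ i i')
    exact ⟨.ball i' (ρ j) ψ, hψ, fun v => forall_congr' fun a => imp_congr_right fun _ =>
      (h _).trans (hi' v a)⟩
  | all i φ ih =>
    obtain ⟨i', hi'⟩ := fresh φ ρ i
    obtain ⟨ψ, hψ, h⟩ := ih (Function.update ρ i i')
    exact ⟨.all i' ψ, fun H => H.elim, fun v => forall_congr' fun a => (h _).trans (hi' v a)⟩

section Definability

variable {N : Type u} {R : N → N → Prop}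

/-- The function `f` of an infinite assignment is a variable or a constant. -/
class Atom (f : (ℕ → N) → N) : Prop where
  out : ∃ a : ℕ ⊕ N, ∀ v, f v = Sum.elim v id a

instance instAtomVar (i : ℕ) : Atom (fun v : ℕ → N => v i) := ⟨.inl i, fun _ => rfl⟩

instance instAtomConst (c : N) : Atom (fun _ : ℕ → N => c) := ⟨.inr c, fun _ => rfl⟩

/-- The predicate `P` is `Δ₀`-definable with parameters in `(N, R)`. -/
class D0 (R : N → N → Prop) (P : (ℕ → N) → Prop) : Prop where
  out : ∃ φ : SetFormula, φ.IsDelta0 ∧ ∃ a : ℕ → ℕ ⊕ N,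
    ∀ v, P v ↔ φ.Sat R (fun k => Sum.elim v id (a k))

/-- The predicate `P` is `Σ₁`-definable with parameters in `(N, R)`. -/
class S1 (R : N → N → Prop) (P : (ℕ → N) → Prop) : Prop where
  out : ∃ Q : (ℕ → N) → N → Prop, D0 R (fun w => Q (fun k => w (k + 1)) (w 0)) ∧
    ∀ v, P v ↔ ∃ y, Q v y

theorem D0.congr {P Q : (ℕ → N) → Prop} (hP : D0 R P) (h : ∀ v, Q v ↔ P v) : D0 R Q := by
  obtain rfl : Q = P := funext fun v => propext (h v)
  exact hP

theorem S1.congr {P Q : (ℕ → N) → Prop} (hP : S1 R P) (h : ∀ v, Q v ↔ P v) : S1 R Q := by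
  obtain rfl : Q = P := funext fun v => propext (h v)
  exact hP

theorem D0.subst {P : (ℕ → N) → Prop} (hP : D0 R P) (σ : ℕ → (ℕ → N) → N)
    (hσ : ∀ k, Atom (σ k)) : D0 R (fun v => P (fun k => σ k v)) := by
  obtain ⟨φ, hφ, a, h⟩ := hP.out
  choose s hs using fun k => (hσ k).out
  refine ⟨φ, hφ, fun k => Sum.elim s .inr (a k), fun v => (h _).trans (iff_of_eq ?_)⟩
  congr 1; funext k
  rcases hk : a k with j | c <;> simp [hs, hk]

theorem S1.subst {P : (ℕ → N) → Prop} (hP : S1 R P) (σ : ℕ → (ℕ → N) → N)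
    (hσ : ∀ k, Atom (σ k)) : S1 R (fun v => P (fun k => σ k v)) := by
  obtain ⟨Q, hQ, h⟩ := hP.out
  refine ⟨fun v y => Q (fun k => σ k v) y, ?_, fun v => h _⟩
  refine hQ.subst (fun | 0 => fun w => w 0 | k + 1 => fun w => σ k (fun k => w (k + 1))) ?_
  rintro (_ | k)
  · exact instAtomVar 0
  · obtain ⟨j | c, hj⟩ := (hσ k).out
    · exact ⟨.inl (j + 1), fun v => hj _⟩
    · exact ⟨.inr c, fun v => hj _⟩

theorem D0.comp2 {op : N → N → Prop} (h : D0 R (fun v => op (v 0) (v 1))) {f g : (ℕ → N) → N}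
    [hf : Atom f] [hg : Atom g] : D0 R (fun v => op (f v) (g v)) :=
  h.subst (fun | 0 => f | _ => g) fun | 0 => hf | _ + 1 => hg

theorem D0.comp3 {op : N → N → N → Prop} (h : D0 R (fun v => op (v 0) (v 1) (v 2)))
    {f g k : (ℕ → N) → N} [hf : Atom f] [hg : Atom g] [hk : Atom k] :
    D0 R (fun v => op (f v) (g v) (k v)) :=
  h.subst (fun | 0 => f | 1 => g | _ => k) fun | 0 => hf | 1 => hg | _ + 2 => hk

instance instD0Mem {f g : (ℕ → N) → N} [hf : Atom f] [hg : Atom g] :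
    D0 R (fun v => R (f v) (g v)) := by
  refine D0.comp2 (op := R) ⟨.mem 0 1, trivial, .inl, fun v => Iff.rfl⟩

instance instD0Eq {f g : (ℕ → N) → N} [hf : Atom f] [hg : Atom g] :
    D0 R (fun v => f v = g v) := by
  refine D0.comp2 (op := Eq) ⟨.eq 0 1, trivial, .inl, fun v => Iff.rfl⟩

instance instD0Not {P : (ℕ → N) → Prop} [hP : D0 R P] : D0 R (fun v => ¬ P v) := by
  obtain ⟨φ, hφ, a, h⟩ := hP.out
  exact ⟨.neg φ, hφ, a, fun v => not_congr (h v)⟩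

instance instD0And {P Q : (ℕ → N) → Prop} [hP : D0 R P] [hQ : D0 R Q] :
    D0 R (fun v => P v ∧ Q v) := by
  obtain ⟨φ, hφ, a, h⟩ := hP.out
  obtain ⟨ψ, hψ, b, h'⟩ := hQ.out
  obtain ⟨φ', hφ', e⟩ := φ.exists_rename R (fun k => 2 * k)
  obtain ⟨ψ', hψ', e'⟩ := ψ.exists_rename R (fun k => 2 * k + 1)
  refine ⟨.and φ' ψ', ⟨hφ' hφ, hψ' hψ⟩, fun k => if k % 2 = 0 then a (k / 2) else b (k / 2),
    fun v => ?_⟩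
  rw [h, h', SetFormula.Sat, e, e']
  have h1 : ∀ k, (2 * k + 1) / 2 = k := by omega
  simp [Nat.add_mod, h1]

instance instD0Or {P Q : (ℕ → N) → Prop} [D0 R P] [D0 R Q] : D0 R (fun v => P v ∨ Q v) :=
  D0.congr (P := fun v => ¬ (¬ P v ∧ ¬ Q v)) inferInstance fun v => by tauto

instance instD0Ball {f : (ℕ → N) → N} {P : (ℕ → N) → N → Prop} [hf : Atom f]
    [hP : D0 R (fun w => P (fun k => w (k + 1)) (w 0))] :
    D0 R (fun v => ∀ x, R x (f v) → P v x) := by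
  classical
  obtain ⟨φ, hφ, a, h⟩ := hP.out
  obtain ⟨B, hB⟩ := φ.exists_bound R
  obtain ⟨ψ, hψ, e⟩ := φ.exists_rename R (fun k => if a k = .inl 0 then B else k)
  obtain ⟨α, hα⟩ := hf.out
  -- Only variables below `B` matter to `φ`, so `B` is free to serve as the quantified variable and
  -- `B + 1` to hold the bounding set.
  refine ⟨.ball B (B + 1) ψ, hψ hφ, fun k => if k = B + 1 then α else
    match a k with | .inl j => .inl (j - 1) | .inr c => .inr c, fun v => ?_⟩
  simp only [SetFormula.Sat, e, if_true, ← hα]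
  refine forall_congr' fun x => imp_congr_right fun _ => ?_
  refine (h (fun k => Nat.casesOn k x v)).trans (hB _ _ fun k hk => ?_)
  rcases hk' : a k with (_ | j) | c
  · simp
  · simp [hk', show k ≠ B by omega, show k ≠ B + 1 by omega]
  · simp [hk', show k ≠ B by omega, show k ≠ B + 1 by omega]

instance instD0Bex {f : (ℕ → N) → N} {P : (ℕ → N) → N → Prop} [hf : Atom f]
    [hP : D0 R (fun w => P (fun k => w (k + 1)) (w 0))] :
    D0 R (fun v => ∃ x, R x (f v) ∧ P v x) :=
  D0.congr (P := fun v => ¬ ∀ x, R x (f v) → ¬ P v x) inferInstance fun v => by simp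

instance (priority := low) instS1D0 {P : (ℕ → N) → Prop} [hP : D0 R P] : S1 R P :=
  ⟨fun v _ => P v, hP.subst (fun k w => w (k + 1)) fun _ => inferInstance,
    fun v => ⟨fun h => ⟨v 0, h⟩, fun ⟨_, h⟩ => h⟩⟩

/-- The structure `(N, R)` is a model of Kripke-Platek set theory. -/
class KPModel (R : N → N → Prop) : Prop where
  out : ModelsKP R

/-- Translates definability with parameters into the shape used in the Kripke–Platek axioms:
variables 0 and 1 carry the arguments, and the parameter of place k moves to variable k + 2. The
element `d` only fills places without a parameter. -/
theorem exists_formula (P : N → N → Prop) [hP : D0 R (fun v => P (v 0) (v 1))] (d : N) :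
    ∃ φ : SetFormula, φ.IsDelta0 ∧ ∃ v : ℕ → N,
      ∀ x y, φ.Sat R (Function.update (Function.update v 0 x) 1 y) ↔ P x y := by
  obtain ⟨φ, hφ, a, h⟩ := hP.out
  obtain ⟨ψ, hψ, e⟩ := φ.exists_rename R
    (fun k => match a k with | .inl 0 => 0 | .inl (_ + 1) => 1 | .inr _ => k + 2)
  refine ⟨ψ, hψ hφ, fun k => Sum.elim (fun _ => d) id (a (k - 2)), fun x y => (e _).trans ?_⟩
  refine Iff.symm <| (h (fun k => Nat.casesOn k x (fun _ => y))).trans (iff_of_eq ?_)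
  congr 1; funext k
  rcases hk : a k with (_ | j) | c <;> simp [hk]

/-! ### Closure of Σ₁-predicates and Σ₁-principles in models of Kripke–Platek set theory -/

variable [KPModel R]

instance instS1Ex {P : (ℕ → N) → N → Prop} [hP : S1 R (fun w => P (fun k => w (k + 1)) (w 0))] :
    S1 R (fun v => ∃ x, P v x) := by
  obtain ⟨Q, hQ, h⟩ := hP.out
  have h' : ∀ v x, P v x ↔ ∃ y, Q (fun k => Nat.casesOn k x v) y :=
    fun v x => h (fun k => Nat.casesOn k x v)
  have : D0 R (fun w => Q (fun k => Nat.casesOn k (w 1) (fun k => w (k + 3))) (w 0)) := by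
    convert hQ.subst (fun | 0 => fun w => w 0 | 1 => fun w => w 1 | k + 2 => fun w => w (k + 3))
      (by rintro (_ | _ | k) <;> exact instAtomVar _) using 3 with w
    funext k; cases k <;> rfl
  -- Two unbounded quantifiers are merged into one over a set that contains both witnesses; pairing
  -- provides it.
  refine ⟨fun v z => ∃ x, R x z ∧ ∃ y, R y z ∧ Q (fun k => Nat.casesOn k x v) y,
    inferInstance, fun v => ?_⟩
  constructor
  · rintro ⟨x, hx⟩
    obtain ⟨y, hy⟩ := (h' v x).1 hx
    obtain ⟨z, hxz, hyz⟩ := (KPModel.out (R := R)).pairing x y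
    exact ⟨z, x, hxz, y, hyz, hy⟩
  · rintro ⟨z, x, -, y, -, hy⟩
    exact ⟨x, (h' v x).2 ⟨y, hy⟩⟩

instance instS1And {P P' : (ℕ → N) → Prop} [hP : S1 R P] [hP' : S1 R P'] :
    S1 R (fun v => P v ∧ P' v) := by
  obtain ⟨Q, hQ, h⟩ := hP.out
  obtain ⟨Q', hQ', h'⟩ := hP'.out
  have h1 : D0 R (fun w => Q (fun k => w (k + 2)) (w 1)) :=
    hQ.subst (fun k w => w (k + 1)) fun _ => inferInstance
  have h2 : D0 R (fun w => Q' (fun k => w (k + 2)) (w 0)) :=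
    hQ'.subst (fun | 0 => fun w => w 0 | k + 1 => fun w => w (k + 2))
      (by rintro (_ | k) <;> exact instAtomVar _)
  refine S1.congr (P := fun v => ∃ y, ∃ y', Q v y ∧ Q' v y') inferInstance fun v => ?_
  rw [h, h']
  simp

instance instS1Or {P P' : (ℕ → N) → Prop} [hP : S1 R P] [hP' : S1 R P'] :
    S1 R (fun v => P v ∨ P' v) := by
  obtain ⟨Q, hQ, h⟩ := hP.out
  obtain ⟨Q', hQ', h'⟩ := hP'.out
  refine ⟨fun v y => Q v y ∨ Q' v y, inferInstance, fun v => ?_⟩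
  rw [h, h', exists_or]

theorem exists_separation (a : N) (P : N → Prop) [hP : D0 R (fun v => P (v 0))] :
    ∃ b, ∀ x, R x b ↔ R x a ∧ P x := by
  obtain ⟨φ, hφ, v, h⟩ := exists_formula (R := R) (fun x _ => P x) a
  obtain ⟨b, hb⟩ := (KPModel.out (R := R)).delta0_separation φ hφ v a
  refine ⟨b, fun x => (hb x).trans (and_congr_right fun _ => ?_)⟩
  rw [← h x (v 1)]
  congr! 1
  funext k
  by_cases hk : k = 1 <;> simp [Function.update_apply, hk]

theorem exists_collection (a : N) (P : N → N → Prop) [hP : D0 R (fun v => P (v 0) (v 1))]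
    (h : ∀ x, R x a → ∃ y, P x y) : ∃ b, ∀ x, R x a → ∃ y, R y b ∧ P x y := by
  obtain ⟨φ, hφ, v, e⟩ := exists_formula (R := R) P a
  obtain ⟨b, hb⟩ := (KPModel.out (R := R)).delta0_collection φ hφ v a
    fun x hx => (h x hx).imp fun y => (e x y).2
  exact ⟨b, fun x hx => (hb x hx).imp fun y hy => ⟨hy.1, (e x y).1 hy.2⟩⟩

/-- Foundation is available for all formulas; here it is applied to the Π₁-formula that expresses
the failure of `P`. -/
theorem kp_induction (P : N → Prop) [hP : S1 R (fun v => P (v 0))]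
    (h : ∀ x, (∀ y, R y x → P y) → P x) (x : N) : P x := by
  obtain ⟨Q, hQ, e⟩ := hP.out
  have : D0 R (fun w => Q (fun _ => w 0) (w 1)) :=
    hQ.subst (fun | 0 => fun w => w 1 | _ + 1 => fun w => w 0)
      (by rintro (_ | k) <;> exact instAtomVar _)
  obtain ⟨φ, hφ, v, e'⟩ := exists_formula (R := R) (fun x y => Q (fun _ => x) y) x
  have key : ∀ x, (SetFormula.all 1 (.neg φ)).Sat R (Function.update v 0 x) ↔ ¬ P x := by
    intro x
    simp only [SetFormula.Sat, e']
    rw [e (fun _ => x), not_exists]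
  by_contra hx
  obtain ⟨y, hy, hmin⟩ := (KPModel.out (R := R)).foundation _ v ⟨x, (key x).2 hx⟩
  exact (key y).1 hy (h y fun z hz => not_not.1 (mt (key z).2 (hmin z hz)))

/-- Collection bounds the witnesses for all x in the set by a single b, which becomes the only
unbounded variable. -/
instance instS1Ball {f : (ℕ → N) → N} {P : (ℕ → N) → N → Prop} [hf : Atom f]
    [hP : S1 R (fun w => P (fun k => w (k + 1)) (w 0))] :
    S1 R (fun v => ∀ x, R x (f v) → P v x) := by
  obtain ⟨Q, hQ, h⟩ := hP.out
  have h' : ∀ v x, P v x ↔ ∃ y, Q (fun k => Nat.casesOn k x v) y :=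
    fun v x => h (fun k => Nat.casesOn k x v)
  have h1 : D0 R (fun w => Q (fun k => Nat.casesOn k (w 1) (fun k => w (k + 3))) (w 0)) := by
    convert hQ.subst (fun | 0 => fun w => w 0 | 1 => fun w => w 1 | k + 2 => fun w => w (k + 3))
      (by rintro (_ | _ | k) <;> exact instAtomVar _) using 3 with w
    funext k; cases k <;> rfl
  have h2 : ∀ v : ℕ → N, D0 R (fun w => Q (fun k => Nat.casesOn k (w 0) v) (w 1)) := by
    intro v
    convert hQ.subst (fun | 0 => fun w => w 1 | 1 => fun w => w 0 | k + 2 => fun _ => v k)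
      (by rintro (_ | _ | k); exacts [instAtomVar _, instAtomVar _, instAtomConst _]) using 3 with w
    funext k; cases k <;> rfl
  have h3 : Atom (fun w : ℕ → N => f (fun k => w (k + 1))) := by
    obtain ⟨j | c, hj⟩ := hf.out
    · exact ⟨.inl (j + 1), fun v => hj _⟩
    · exact ⟨.inr c, fun v => hj _⟩
  refine ⟨fun v b => ∀ x, R x (f v) → ∃ y, R y b ∧ Q (fun k => Nat.casesOn k x v) y,
    inferInstance, fun v => ?_⟩
  constructor
  · exact fun H => exists_collection (f v) (fun x y => Q (fun k => Nat.casesOn k x v) y)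
      fun x hx => (h' v x).1 (H x hx)
  · rintro ⟨b, hb⟩ x hx
    obtain ⟨y, -, hy⟩ := hb x hx
    exact (h' v x).2 ⟨y, hy⟩

/-- Strong `Σ₁`-collection. -/
theorem exists_strong_collection (a : N) (P : N → N → Prop) [hP : S1 R (fun v => P (v 0) (v 1))]
    (h : ∀ x, R x a → ∃ y, P x y) :
    ∃ b, (∀ x, R x a → ∃ y, R y b ∧ P x y) ∧ ∀ y, R y b → ∃ x, R x a ∧ P x y := by
  obtain ⟨Q, hQ, e⟩ := hP.out
  have e' : ∀ x y, P x y ↔ ∃ z, Q (fun k => Nat.casesOn k x fun _ => y) z :=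
    fun x y => e (fun k => Nat.casesOn k x fun _ => y)
  have hQ' : D0 R (fun w => Q (fun k => Nat.casesOn k (w 0) fun _ => w 1) (w 2)) := by
    convert hQ.subst (fun | 0 => fun w => w 2 | 1 => fun w => w 0 | k + 2 => fun w => w 1)
      (by rintro (_ | _ | k) <;> exact instAtomVar _) using 3 with w
    funext k; cases k <;> rfl
  have h3 : ∀ i j k, D0 R (fun w => Q (fun m => Nat.casesOn m (w i) fun _ => w j) (w k)) :=
    fun i j k => D0.comp3 (op := fun x y z => Q (fun m => Nat.casesOn m x fun _ => y) z) hQ'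
  -- Each s contains a value y together with a witness z for it. The set `b₁` then bounds both, so
  -- that the values with a witness in `b₁` can be selected by Δ₀-separation.
  obtain ⟨b₀, hb₀⟩ := exists_collection (R := R) a (fun x s => ∃ y, R y s ∧ ∃ z, R z s ∧
    Q (fun k => Nat.casesOn k x fun _ => y) z) fun x hx => by
      obtain ⟨y, hy⟩ := h x hx
      obtain ⟨z, hz⟩ := (e' x y).1 hy
      obtain ⟨s, hys, hzs⟩ := (KPModel.out (R := R)).pairing y z
      exact ⟨s, y, hys, z, hzs, hz⟩
  obtain ⟨b₁, hb₁⟩ := (KPModel.out (R := R)).union b₀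
  obtain ⟨b, hb⟩ := exists_separation (R := R) b₁ (fun y => ∃ x, R x a ∧ ∃ z, R z b₁ ∧
    Q (fun k => Nat.casesOn k x fun _ => y) z)
  refine ⟨b, fun x hx => ?_, fun y hy => ?_⟩
  · obtain ⟨s, hs, y, hy, z, hz, hQ⟩ := hb₀ x hx
    exact ⟨y, (hb y).2 ⟨hb₁ s y hs hy, x, hx, z, hb₁ s z hs hz, hQ⟩, (e' x y).2 ⟨z, hQ⟩⟩
  · obtain ⟨x, hx, z, -, hz⟩ := ((hb y).1 hy).2
    exact ⟨x, hx, (e' x y).2 ⟨z, hz⟩⟩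

theorem S1.exists_fin {m : ℕ} : ∀ {P : (ℕ → N) → (Fin m → N) → Prop},
    S1 R (fun w => P (fun k => w (k + m)) (fun i : Fin m => w i)) →
      S1 R (fun v => ∃ u : Fin m → N, P v u) := by
  induction m with
  | zero =>
    intro P h
    refine h.congr fun v => ⟨fun ⟨u, hu⟩ => ?_, fun h => ⟨_, h⟩⟩
    obtain rfl : u = fun i : Fin 0 => v i := funext fun i => i.elim0
    exact hu
  | succ m ih =>
    intro P h
    have : S1 R (fun v => ∃ u : Fin m → N, ∃ x, P v (Fin.cons x u)) := by
      refine ih (P := fun v u => ∃ x, P v (Fin.cons x u)) ?_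
      have : S1 R (fun w => P (fun k => w (k + m + 1)) (Fin.cons (w 0) fun i => w (i + 1))) := by
        have e : ∀ w : ℕ → N, (Fin.cons (w 0) fun i : Fin m => w (i + 1)) =
            fun i : Fin (m + 1) => w i := fun w => funext fun i => Fin.cases rfl (fun i => rfl) i
        simp only [e]
        exact h
      infer_instance
    refine this.congr fun v => ⟨fun ⟨u, hu⟩ => ⟨Fin.tail u, u 0, ?_⟩, fun ⟨u, x, h⟩ => ⟨_, h⟩⟩
    rwa [Fin.cons_self_tail]

theorem S1.forall_fin {m : ℕ} : ∀ {P : Fin m → (ℕ → N) → Prop}, (∀ i, S1 R (P i)) →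
    S1 R (fun v => ∀ i, P i v) := by
  induction m with
  | zero => exact fun _ => S1.congr (P := fun v => v 0 = v 0) inferInstance fun v => by simp
  | succ m ih =>
    intro P h
    have h0 := h 0
    have := ih fun i => h i.succ
    exact S1.congr (P := fun v => P 0 v ∧ ∀ i : Fin m, P i.succ v) inferInstance
      fun v => Fin.forall_fin_succ

end Definability

/-! ### Primitive recursive set functions on admissible sets -/

section Admissible

variable {M : Type u} [PRSetModel M] {A : M}

/-- The set `A` is admissible. -/
class Admissible (A : M) : Prop where
  out : IsAdmissible A

/-- The elements of `A`. -/
abbrev El (A : M) : Type u := {x : M // x ∈ₛ A}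

/-- The membership relation on `A`. -/
def relA (A : M) : El A → El A → Prop := fun x y => x.1 ∈ₛ y.1

variable [hA : Admissible A]

instance instKPModelRelA : KPModel (relA A) := ⟨hA.out.2.2⟩

theorem Admissible.trans {x y : M} (hy : y ∈ₛ A) (hx : x ∈ₛ y) : x ∈ₛ A := hA.out.1 y hy x hx

/-- Since A is transitive, a set separated inside A has the same elements in M, and extensionality
of M identifies it with `c`. -/
theorem mem_of_separation (a : El A) (P : El A → Prop) [D0 (relA A) (fun v => P (v 0))] {c : M}
    (h : ∀ x, x ∈ₛ c ↔ ∃ hx : x ∈ₛ a.1, P ⟨x, Admissible.trans a.2 hx⟩) : c ∈ₛ A := by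
  obtain ⟨b, hb⟩ := exists_separation (R := relA A) a P
  convert b.2
  refine ext fun x => (h x).trans ⟨fun ⟨hx, hP⟩ => (hb ⟨x, Admissible.trans a.2 hx⟩).2 ⟨hx, hP⟩,
    fun hx => ?_⟩
  have := (hb ⟨x, Admissible.trans b.2 hx⟩).1 hx
  exact ⟨this.1, this.2⟩

theorem emp_mem_A : (emp : M) ∈ₛ A := by
  obtain ⟨w, hw, hwA⟩ := hA.out.2.1
  exact Admissible.trans hwA hw.1.1

theorem upair_mem_A {x y : M} (hx : x ∈ₛ A) (hy : y ∈ₛ A) : upair x y ∈ₛ A := by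
  obtain ⟨z, hxz, hyz⟩ := hA.out.2.2.pairing ⟨x, hx⟩ ⟨y, hy⟩
  refine mem_of_separation z (fun t => t = ⟨x, hx⟩ ∨ t = ⟨y, hy⟩) fun t => ?_
  rw [mem_upair]
  constructor
  · rintro (rfl | rfl)
    · exact ⟨hxz, .inl rfl⟩
    · exact ⟨hyz, .inr rfl⟩
  · rintro ⟨_, h⟩
    simpa using h

theorem opair_mem_A {x y : M} (hx : x ∈ₛ A) (hy : y ∈ₛ A) : opair x y ∈ₛ A :=
  upair_mem_A (upair_mem_A hx hx) (upair_mem_A hx hy)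

theorem sU_mem_A {x : M} (hx : x ∈ₛ A) : sU x ∈ₛ A := by
  obtain ⟨z, hz⟩ := hA.out.2.2.union ⟨x, hx⟩
  refine mem_of_separation z (fun t => ∃ y, relA A y ⟨x, hx⟩ ∧ relA A t y) fun t => ?_
  rw [mem_sU]
  constructor
  · rintro ⟨y, hy, ht⟩
    have hyA := Admissible.trans hx hy
    exact ⟨hz ⟨y, hyA⟩ ⟨t, Admissible.trans hyA ht⟩ hy ht, ⟨y, hyA⟩, hy, ht⟩
  · rintro ⟨_, y, hy, ht⟩
    exact ⟨y, hy, ht⟩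

theorem adj_mem_A {x y : M} (hx : x ∈ₛ A) (hy : y ∈ₛ A) : adj x y ∈ₛ A := by
  have : adj x y = un x (upair y y) := ext fun t => by simp [mem_adj, mem_un, mem_upair]
  rw [this]
  exact sU_mem_A (upair_mem_A hx (upair_mem_A hy hy))

instance instD0Upair {f g h : (ℕ → El A) → El A} [Atom f] [Atom g] [Atom h] :
    D0 (relA A) (fun v => (f v).1 = upair (g v).1 (h v).1) := by
  refine D0.comp3 (op := fun x y z : El A => x.1 = upair y.1 z.1) ?_
  refine D0.congr (P := fun v => (relA A (v 1) (v 0) ∧ relA A (v 2) (v 0)) ∧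
    ∀ t, relA A t (v 0) → t = v 1 ∨ t = v 2) inferInstance fun v => ?_
  constructor
  · intro h
    simp only [relA, h, mem_upair, true_or, or_true, and_self, true_and]
    exact fun t ht => ht.imp Subtype.ext Subtype.ext
  · rintro ⟨⟨h1, h2⟩, h3⟩
    refine ext fun t => Iff.trans ⟨fun ht => ?_, ?_⟩ mem_upair.symm
    · exact (h3 ⟨t, Admissible.trans (v 0).2 ht⟩ ht).imp (congrArg Subtype.val) (congrArg Subtype.val)
    · rintro (rfl | rfl)
      exacts [h1, h2]

instance instD0Opair {f g h : (ℕ → El A) → El A} [Atom f] [Atom g] [Atom h] :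
    D0 (relA A) (fun v => (f v).1 = opair (g v).1 (h v).1) := by
  refine D0.comp3 (op := fun x y z : El A => x.1 = opair y.1 z.1) ?_
  refine D0.congr (P := fun v => ∃ a, relA A a (v 0) ∧ ∃ b, relA A b (v 0) ∧
    a.1 = upair (v 1).1 (v 1).1 ∧ b.1 = upair (v 1).1 (v 2).1 ∧ (v 0).1 = upair a.1 b.1)
    inferInstance fun v => ?_
  constructor
  · intro h
    refine ⟨⟨_, upair_mem_A (v 1).2 (v 1).2⟩, ?_, ⟨_, upair_mem_A (v 1).2 (v 2).2⟩, ?_, rfl, rfl, h⟩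
    · simp [relA, h, opair, mem_upair]
    · simp [relA, h, opair, mem_upair]
  · rintro ⟨a, -, b, -, ha, hb, h⟩
    rw [h, ha, hb, opair]

instance instD0OpairMem {f g h : (ℕ → El A) → El A} [Atom f] [Atom g] [Atom h] :
    D0 (relA A) (fun v => opair (f v).1 (g v).1 ∈ₛ (h v).1) := by
  refine D0.comp3 (op := fun x y z : El A => opair x.1 y.1 ∈ₛ z.1) ?_
  refine D0.congr (P := fun v => ∃ p, relA A p (v 2) ∧ p.1 = opair (v 0).1 (v 1).1)
    inferInstance fun v => ⟨fun h => ⟨⟨_, Admissible.trans (v 2).2 h⟩, h, rfl⟩, ?_⟩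
  rintro ⟨p, hp, h⟩
  exact h ▸ (show p.1 ∈ₛ (v 2).1 from hp)

/-- The set `A` is closed under the function symbol `F`, and the restriction of `F` to `A` has a
`Σ₁`-definable graph. -/
def SigmaOn (A : M) {n : ℕ} (F : PRSetFun n) : Prop :=
  (∀ v : Fin n → El A, fn F (fun i => (v i).1) ∈ₛ A) ∧
    S1 (relA A) (fun w => (w 0).1 = fn F (fun i : Fin n => (w (i + 1)).1))

omit hA in
theorem SigmaOn.graph {n : ℕ} {F : PRSetFun n} (h : SigmaOn A F) {y : (ℕ → El A) → El A}
    {u : Fin n → (ℕ → El A) → El A} (hy : Atom y) (hu : ∀ i, Atom (u i)) :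
    S1 (relA A) (fun w => (y w).1 = fn F (fun i => (u i w).1)) := by
  have := h.2.subst (fun | 0 => y | k + 1 => if h : k < n then u ⟨k, h⟩ else y) ?_
  · simpa using this
  · rintro (_ | k)
    · exact hy
    · by_cases h : k < n
      · simpa [h] using hu _
      · simpa [h] using hy

/-- The set `f` consists of correct steps of the recursion for the symbol `g` with parameters
`v`, each of which is based on other steps in `f`. -/
def Computation {n : ℕ} (g : PRSetFun (n + 2)) (f : El A) (v : Fin n → El A) : Prop :=
  ∀ p, relA A p f → ∃ x y c : El A, p.1 = opair x.1 y.1 ∧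
    (∀ w, relA A w x → ∃ u : El A, opair w.1 u.1 ∈ₛ f.1 ∧ ∀ t, relA A t u → relA A t c) ∧
    (∀ t, relA A t c → ∃ w, relA A w x ∧ ∃ u : El A, opair w.1 u.1 ∈ₛ f.1 ∧ relA A t u) ∧
    y.1 = fn g (Fin.cons c.1 (Fin.cons x.1 fun i => (v i).1))

/-! ### Σ₁-recursion over sets via computations -/

section Recursion

variable {n : ℕ} {g : PRSetFun (n + 2)}

omit hA in
theorem Computation.mono_step {f f' : El A} {v : Fin n → El A} (hf : Computation g f v)
    (hff' : Subset f.1 f'.1) (p : El A) (hp : relA A p f) : ∃ x y c : El A, p.1 = opair x.1 y.1 ∧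
    (∀ w, relA A w x → ∃ u : El A, opair w.1 u.1 ∈ₛ f'.1 ∧ ∀ t, relA A t u → relA A t c) ∧
    (∀ t, relA A t c → ∃ w, relA A w x ∧ ∃ u : El A, opair w.1 u.1 ∈ₛ f'.1 ∧ relA A t u) ∧
    y.1 = fn g (Fin.cons c.1 (Fin.cons x.1 fun i => (v i).1)) := by
  obtain ⟨x, y, c, h1, h2, h3, h4⟩ := hf p hp
  refine ⟨x, y, c, h1, fun w hw => ?_, fun t ht => ?_, h4⟩
  · obtain ⟨u, hu, h⟩ := h2 w hw
    exact ⟨u, hff' _ hu, h⟩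
  · obtain ⟨w, hw, u, hu, h⟩ := h3 t ht
    exact ⟨w, hw, u, hff' _ hu, h⟩

theorem Computation.sigma (hg : SigmaOn A g) {f : (ℕ → El A) → El A}
    {v : Fin n → (ℕ → El A) → El A} (hf : Atom f) (hv : ∀ i, Atom (v i)) :
    S1 (relA A) (fun w => Computation g (f w) (fun i => v i w)) := by
  have key : S1 (relA A) (fun w => Computation g (w 0) (fun i : Fin n => w (i + 1))) := by
    have : S1 (relA A) (fun w => (w 1).1 =
        fn g (Fin.cons (w 0).1 (Fin.cons (w 2).1 fun i : Fin n => (w (i + 5)).1))) := by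
      convert hg.graph (y := fun w => w 1) (u := Fin.cons (fun w => w 0) (Fin.cons (fun w => w 2)
        fun i w => w (i + 5))) inferInstance ?_ using 4 with w
      · funext i
        refine Fin.cases rfl (fun i => Fin.cases rfl (fun i => rfl) i) i
      · refine fun i => Fin.cases (instAtomVar 0)
          (fun i => Fin.cases (instAtomVar 2) (fun i => instAtomVar (i + 5)) i) i
    simp only [Computation]
    infer_instance
  have := key.subst (fun | 0 => f | k + 1 => if h : k < n then v ⟨k, h⟩ else f) ?_
  · simpa using this
  · rintro (_ | k)
    · exact hf
    · by_cases h : k < n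
      · simpa [h] using hv _
      · simpa [h] using hf

theorem fn_recur_eq {z c : M} {v : Fin n → M}
    (h : ∀ t, t ∈ₛ c ↔ ∃ w, w ∈ₛ z ∧ t ∈ₛ fn (.recur g) (Fin.cons w v)) :
    fn (.recur g) (Fin.cons z v) = fn g (Fin.cons c (Fin.cons z v)) := by
  obtain ⟨c', hc, h'⟩ := fn_recur g z v
  obtain rfl : c = c' := ext fun t => (h t).trans (hc t).symm
  exact h'

/-- The induction runs in M along the transitive set A: the function symbol already has an
interpretation there, so the claim is primitive recursive. It follows that computations are
single-valued and agree with each other, although the definition demands neither. -/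
theorem Computation.correct {f : El A} {v : Fin n → El A} (hf : Computation g f v) :
    ∀ x y : El A, opair x.1 y.1 ∈ₛ f.1 → y.1 = fn (.recur g) (Fin.cons x.1 fun i => (v i).1) := by
  have hPR : PR Any (fun w : ℕ → M => fn (.recur g) (Fin.cons (w 1) fun i => (v i).1)) := by
    convert PR.app (.recur g) (Fin.cons (fun w => w 1) fun i _ => (v i).1) ?_ using 3 with w
    · funext i
      refine Fin.cases rfl (fun i => rfl) i
    · refine fun i => Fin.cases (instPRVar 1) (fun i => instPRAny _) i
  have := mem_induction hA.out.1 (fun x => ∀ y, y ∈ₛ A → opair x y ∈ₛ f.1 →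
    y = fn (.recur g) (Fin.cons x fun i => (v i).1)) ?_
  · exact fun x y h => this x.1 x.2 y.1 y.2 h
  · intro x hx ih y hy h
    obtain ⟨x', y', c, h1, h2, h3, h4⟩ := hf ⟨_, Admissible.trans f.2 h⟩ h
    obtain ⟨rfl, rfl⟩ := opair_inj h1
    rw [h4]
    refine (fn_recur_eq fun t => ?_).symm
    constructor
    · intro ht
      obtain ⟨w, hw, u, hu, htu⟩ := h3 ⟨t, Admissible.trans c.2 ht⟩ ht
      exact ⟨w.1, hw, ih w.1 hw u.1 u.2 hu ▸ htu⟩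
    · rintro ⟨w, hw, ht⟩
      obtain ⟨u, hu, huc⟩ := h2 ⟨w, Admissible.trans x'.2 hw⟩ hw
      rw [← ih w hw u.1 u.2 hu] at ht
      exact huc ⟨t, Admissible.trans u.2 ht⟩ ht

/-- By Σ₁-induction on z. Strong collection gathers computations for the elements of z, without
admitting anything else, so their union is again a computation; one step for z is added to it. The
values for the elements of z are collected in `d`, and the union of `d` is the input of the new
step. -/
theorem Computation.total (hg : SigmaOn A g) (v : Fin n → El A) (z : El A) :
    ∃ f, Computation g f v ∧ ∃ y : El A, opair z.1 y.1 ∈ₛ f.1 := by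
  have hS : ∀ i, S1 (relA A) (fun w => Computation g (w i) v) := fun i =>
    Computation.sigma hg (v := fun i _ => v i) (instAtomVar i) fun i => inferInstance
  have h0 := hS 0
  have h1 := hS 1
  refine kp_induction (R := relA A)
    (fun z => ∃ f, Computation g f v ∧ ∃ y : El A, opair z.1 y.1 ∈ₛ f.1) (fun z ih => ?_) z
  obtain ⟨b, hb, hb'⟩ := exists_strong_collection (R := relA A) z
    (fun w f => Computation g f v ∧ ∃ y : El A, opair w.1 y.1 ∈ₛ f.1) ih
  obtain ⟨d, hd, hd'⟩ := exists_strong_collection (R := relA A) z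
    (fun w u => ∃ f, Computation g f v ∧ opair w.1 u.1 ∈ₛ f.1) fun w hw => by
      obtain ⟨f, hf, y, hy⟩ := ih w hw
      exact ⟨y, f, hf, hy⟩
  let c : El A := ⟨sU d.1, sU_mem_A d.2⟩
  have hc : ∀ t, t ∈ₛ c.1 ↔ ∃ w, w ∈ₛ z.1 ∧
      t ∈ₛ fn (.recur g) (Fin.cons w fun i => (v i).1) := by
    intro t
    rw [mem_sU]
    constructor
    · rintro ⟨u, hu, ht⟩
      obtain ⟨w, hw, f, hf, hwu⟩ := hd' ⟨u, Admissible.trans d.2 hu⟩ hu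
      exact ⟨w.1, hw, hf.correct _ _ hwu ▸ ht⟩
    · rintro ⟨w, hw, ht⟩
      obtain ⟨u, hu, f, hf, hwu⟩ := hd ⟨w, Admissible.trans z.2 hw⟩ hw
      exact ⟨u.1, hu, hf.correct _ _ hwu ▸ ht⟩
  let y : El A := ⟨fn g (Fin.cons c.1 (Fin.cons z.1 fun i => (v i).1)), by
    convert hg.1 (Fin.cons c (Fin.cons z v)) using 2
    funext i
    refine Fin.cases rfl (fun i => Fin.cases rfl (fun i => rfl) i) i⟩
  let f : El A := ⟨adj (sU b.1) (opair z.1 y.1), adj_mem_A (sU_mem_A b.2) (opair_mem_A z.2 y.2)⟩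
  have hbf : ∀ f', relA A f' b → Subset f'.1 f.1 := fun f' hf' t ht =>
    mem_adj.2 (.inl (mem_sU.2 ⟨f'.1, hf', ht⟩))
  refine ⟨f, fun p hp => ?_, y, mem_adj.2 (.inr rfl)⟩
  rcases mem_adj.1 hp with hp | hp
  · obtain ⟨f', hf', hpf'⟩ := mem_sU.1 hp
    obtain ⟨-, -, hC, -⟩ := hb' ⟨f', Admissible.trans b.2 hf'⟩ hf'
    exact hC.mono_step (hbf _ hf') p hpf'
  · have key : ∀ w, relA A w z → ∃ u : El A, opair w.1 u.1 ∈ₛ f.1 ∧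
        u.1 = fn (.recur g) (Fin.cons w.1 fun i => (v i).1) := by
      intro w hw
      obtain ⟨f', hf', hC, u, hu⟩ := hb w hw
      exact ⟨u, hbf f' hf' _ hu, hC.correct _ _ hu⟩
    refine ⟨z, y, c, hp, fun w hw => ?_, fun t ht => ?_, rfl⟩
    · obtain ⟨u, hu, hu'⟩ := key w hw
      exact ⟨u, hu, fun t ht => (hc _).2 ⟨w.1, hw, hu' ▸ ht⟩⟩
    · obtain ⟨w, hw, ht⟩ := (hc _).1 ht
      obtain ⟨u, hu, hu'⟩ := key ⟨w, Admissible.trans z.2 hw⟩ hw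
      exact ⟨⟨w, Admissible.trans z.2 hw⟩, hw, u, hu,
        show t.1 ∈ₛ u.1 from hu'.symm ▸ ht⟩

theorem SigmaOn.recur (hg : SigmaOn A g) : SigmaOn A (.recur g) := by
  have hcons : ∀ v : Fin (n + 1) → El A, (fun i => (v i).1) =
      (Fin.cons (v 0).1 fun i => (v i.succ).1 : Fin (n + 1) → M) := fun v =>
    funext fun i => Fin.cases rfl (fun i => rfl) i
  constructor
  · intro v
    obtain ⟨f, hf, y, hy⟩ := Computation.total hg (fun i => v i.succ) (v 0)
    rw [hcons v, ← hf.correct _ _ hy]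
    exact y.2
  · have : S1 (relA A) (fun w => Computation g (w 0) (fun i : Fin n => w (i + 3))) :=
      Computation.sigma hg (f := fun w => w 0) (v := fun i w => w (i + 3)) inferInstance
        fun i => inferInstance
    refine S1.congr (P := fun w => ∃ f, Computation g f (fun i : Fin n => w (i + 2)) ∧
      opair (w 1).1 (w 0).1 ∈ₛ f.1) inferInstance fun w => ?_
    rw [hcons fun i => w (i + 1)]
    constructor
    · intro h
      obtain ⟨f, hf, y, hy⟩ := Computation.total hg (fun i : Fin n => w (i + 2)) (w 1)
      have := hf.correct _ _ hy
      refine ⟨f, hf, ?_⟩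
      convert hy using 2
      rw [this, h]; rfl
    · rintro ⟨f, hf, h⟩
      exact hf.correct _ _ h

end Recursion

theorem SigmaOn.comp {m n : ℕ} {g : PRSetFun m} {h : Fin m → PRSetFun n} (hg : SigmaOn A g)
    (hh : ∀ i, SigmaOn A (h i)) : SigmaOn A (.comp g h) := by
  constructor
  · intro v
    rw [fn_comp]
    exact hg.1 fun i => ⟨_, (hh i).1 v⟩
  · have h1 := hg.graph (y := fun w => w m) (u := fun i w => w i) inferInstance
      fun i => inferInstance
    have h2 : S1 (relA A) (fun w => ∀ i : Fin m, (w i).1 = fn (h i)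
        (fun j : Fin n => (w (j + 1 + m)).1)) :=
      S1.forall_fin fun i => (hh i).graph (y := fun w => w i) (u := fun j w => w (j + 1 + m))
        inferInstance fun i => inferInstance
    refine S1.congr (P := fun w => ∃ u : Fin m → El A,
      (∀ i, (u i).1 = fn (h i) (fun j : Fin n => (w (j + 1)).1)) ∧
        (w 0).1 = fn g (fun i => (u i).1)) ?_ fun w => ?_
    · refine S1.exists_fin (P := fun (w : ℕ → El A) (u : Fin m → El A) =>
        (∀ i, (u i).1 = fn (h i) (fun j : Fin n => (w (j + 1)).1)) ∧
        (w 0).1 = fn g (fun i => (u i).1)) ?_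
      simp only [Nat.zero_add]
      infer_instance
    · rw [fn_comp]
      constructor
      · exact fun e => ⟨fun i => ⟨_, (hh i).1 fun j : Fin n => w (j + 1)⟩, fun i => rfl, e⟩
      · rintro ⟨u, hu, e⟩
        simp only [e, hu]

/-- External induction on the symbol. Initial functions have Δ₀-graphs, substitution adds finitely
many existential quantifiers for intermediate values, and recursion is handled by computations. -/
theorem sigmaOn {n : ℕ} (F : PRSetFun n) : SigmaOn A F := by
  induction F with
  | zero =>
    have h0 : ∀ {n : ℕ} (v : Fin n → M), fn PRSetFun.zero v = emp := fun v =>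
      ext fun z => iff_of_false (fn_zero v z) (not_mem_emp z)
    refine ⟨fun v => h0 _ ▸ emp_mem_A, ?_⟩
    refine S1.congr (P := fun w => ∀ t, relA A t (w 0) → ¬ t = t) inferInstance fun w => ?_
    rw [h0]
    constructor
    · exact fun h t ht => absurd (show t.1 ∈ₛ emp from h ▸ (show t.1 ∈ₛ (w 0).1 from ht)) (not_mem_emp _)
    · exact fun h => ext fun z => iff_of_false
        (fun hz => h ⟨z, Admissible.trans (w 0).2 hz⟩ hz rfl) (not_mem_emp z)
  | proj i =>
    simp only [SigmaOn, fn_proj]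
    refine ⟨fun v => (v i).2, ?_⟩
    exact S1.congr (P := fun w => w 0 = w (i + 1)) (inferInstance : S1 (relA A) _) fun w => Subtype.ext_iff.symm
  | adjoin =>
    have h2 : ∀ v : Fin 2 → M, fn PRSetFun.adjoin v = adj (v 0) (v 1) := fun v => by
      rw [adj]; congr 1; funext i; fin_cases i <;> rfl
    refine ⟨fun v => h2 _ ▸ adj_mem_A (v 0).2 (v 1).2, ?_⟩
    refine S1.congr (P := fun w => (∀ t, relA A t (w 0) → relA A t (w 1) ∨ t = w 2) ∧
      (∀ t, relA A t (w 1) → relA A t (w 0)) ∧ relA A (w 2) (w 0)) inferInstance fun w => ?_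
    rw [h2]
    constructor
    · intro h
      simp only [relA, h, mem_adj]
      exact ⟨fun t ht => ht.imp_right Subtype.ext, fun t ht => .inl ht, .inr rfl⟩
    · rintro ⟨h1, h2, h3⟩
      refine ext fun t => Iff.trans ⟨fun ht => ?_, ?_⟩ mem_adj.symm
      · exact (h1 ⟨t, Admissible.trans (w 0).2 ht⟩ ht).imp_right (congrArg Subtype.val)
      · rintro (ht | rfl)
        · exact h2 ⟨t, Admissible.trans (w 1).2 ht⟩ ht
        · exact h3
  | cond =>
    have h4 : ∀ v : Fin 4 → M, fn PRSetFun.cond v = cset (v 2 ∈ₛ v 3) (v 0) (v 1) := fun v => by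
      have : v = ![v 0, v 1, v 2, v 3] := by funext i; fin_cases i <;> rfl
      by_cases h : v 2 ∈ₛ v 3
      · rw [cset_pos h, this]; exact fn_cond_pos _ _ _ _ h
      · rw [cset_neg h, this]; exact fn_cond_neg _ _ _ _ h
    constructor
    · intro v
      rw [h4]
      by_cases h : (v 2).1 ∈ₛ (v 3).1
      · rw [cset_pos h]; exact (v 0).2
      · rw [cset_neg h]; exact (v 1).2
    · refine S1.congr (P := fun w => relA A (w 3) (w 4) ∧ w 0 = w 1 ∨
        ¬ relA A (w 3) (w 4) ∧ w 0 = w 2) inferInstance fun w => ?_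
      rw [h4]
      by_cases h : (w 3).1 ∈ₛ (w 4).1
      · rw [cset_pos (by exact h)]
        simp [relA, h, Subtype.ext_iff]
      · rw [cset_neg (by exact h)]
        simp [relA, h, Subtype.ext_iff]
  | comp g h hg hh => exact hg.comp hh
  | recur g hg => exact hg.recur

/-- Parameters from `A`. -/
def InA (A : M) : M → Prop := fun x => x ∈ₛ A

theorem PR.mem_A {f : (ℕ → M) → M} (hf : PR (InA A) f) (v : ℕ → M) (hv : ∀ k, v k ∈ₛ A) :
    f v ∈ₛ A := by
  obtain ⟨n, F, a, h⟩ := hf.out.normal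
  rw [h]
  exact (sigmaOn F).1 fun i => ⟨_, by
    rcases a i with k | c
    · exact hv k
    · exact c.2⟩

theorem mem_A (t : M) [ht : PR (InA A) (fun _ => t)] : t ∈ₛ A :=
  ht.mem_A (fun _ => emp) fun _ => emp_mem_A

/-- The characteristic function of `P` has a Σ₁-graph over A, and `P` holds when its value is {∅}.
Hence `P` is Σ₁ over A and strong collection applies. -/
theorem pr_collection {a : M} (ha : a ∈ₛ A) (P : M → M → Prop)
    [hP : PRP (InA A) (fun v => P (v 0) (v 1))] (h : ∀ x, x ∈ₛ a → ∃ y, y ∈ₛ A ∧ P x y) :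
    ∃ b, b ∈ₛ A ∧ (∀ x, x ∈ₛ a → ∃ y, y ∈ₛ b ∧ P x y) ∧
      ∀ y, y ∈ₛ b → ∃ x, x ∈ₛ a ∧ P x y := by
  obtain ⟨n, F, c, hF⟩ := hP.out.out.normal
  let one : El A := ⟨upair emp emp, upair_mem_A emp_mem_A emp_mem_A⟩
  let U : Fin n → (ℕ → El A) → El A := fun i v => Sum.elim v (fun c => ⟨c.1, c.2⟩) (c i)
  have hS : S1 (relA A) (fun w => P (w 0).1 (w 1).1) := by
    refine S1.congr ((sigmaOn F).graph (y := fun _ => one) (u := U) inferInstance fun i => ?_)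
      fun w => ?_
    · simp only [U]
      rcases c i with k | c
      · exact instAtomVar k
      · exact instAtomConst _
    · have : fn F (fun i => (U i w).1) = cset (P (w 0).1 (w 1).1) (upair emp emp) emp := by
        rw [hF fun k => (w k).1]
        congr 1; funext i
        simp only [U]
        rcases c i with k | c <;> rfl
      rw [this]
      by_cases h : P (w 0).1 (w 1).1
      · simp only [h, cset_pos, one]
      · simp only [h, cset_neg, not_false_eq_true, one, false_iff]
        intro e
        have h0 : (emp : M) ∈ₛ upair emp emp := mem_upair.2 (.inl rfl)
        exact not_mem_emp _ (e.subst (motive := fun t : M => emp ∈ₛ t) h0)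
  obtain ⟨b, hb, hb'⟩ := exists_strong_collection (R := relA A) ⟨a, ha⟩
    (fun x y => P x.1 y.1) fun x hx => by
    obtain ⟨y, hy, hxy⟩ := h x.1 hx
    exact ⟨⟨y, hy⟩, hxy⟩
  refine ⟨b.1, b.2, fun x hx => ?_, fun y hy => ?_⟩
  · obtain ⟨y, hy, h⟩ := hb ⟨x, Admissible.trans ha hx⟩ hx
    exact ⟨y.1, hy, h⟩
  · obtain ⟨x, hx, h⟩ := hb' ⟨y, Admissible.trans b.2 hy⟩ hy
    exact ⟨x.1, hx, h⟩

end Admissible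

/-! ### Ordinals -/

section Ordinals

variable {M : Type u} [PRSetModel M] {B : M → Prop}

theorem Subset.refl (x : M) : Subset x x := fun _ h => h

theorem Subset.trans {x y z : M} (h : Subset x y) (h' : Subset y z) : Subset x z :=
  fun t ht => h' t (h t ht)

theorem IsOrdinal.of_mem {a b : M} (ha : IsOrdinal a) (hb : b ∈ₛ a) : IsOrdinal b :=
  ⟨ha.2 b hb, fun y hy => ha.2 y (ha.1 b hb y hy)⟩

theorem isOrdinal_adj {a : M} (ha : IsOrdinal a) : IsOrdinal (adj a a) := by
  refine ⟨fun y hy z hz => mem_adj.2 (.inl ?_), fun y hy => ?_⟩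
  · rcases mem_adj.1 hy with hy | rfl
    · exact ha.1 y hy z hz
    · exact hz
  · rcases mem_adj.1 hy with hy | rfl
    · exact ha.2 y hy
    · exact ha.1

/-- Take x minimal such that some y is incomparable to it, then y minimal for this x; both then have
the same elements. The search ranges over a ∪ {a} and b ∪ {b}, so that the given pair is among the
candidates. -/
theorem IsOrdinal.trichotomy {a b : M} (ha : IsOrdinal a) (hb : IsOrdinal b) :
    a ∈ₛ b ∨ a = b ∨ b ∈ₛ a := by
  by_contra h
  have ha' := isOrdinal_adj ha
  have hb' := isOrdinal_adj hb
  obtain ⟨x, hx, ⟨y₀, hy₀, hxy₀⟩, hmin⟩ := exists_minimal (a := adj a a)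
    (fun x => ∃ y, y ∈ₛ adj b b ∧ ¬ (x ∈ₛ y ∨ x = y ∨ y ∈ₛ x))
    ⟨a, mem_adj.2 (.inr rfl), b, mem_adj.2 (.inr rfl), h⟩
  obtain ⟨y, hy, hxy, hmin'⟩ := exists_minimal (a := adj b b)
    (fun y => ¬ (x ∈ₛ y ∨ x = y ∨ y ∈ₛ x)) ⟨y₀, hy₀, hxy₀⟩
  have hxo := ha'.of_mem hx
  have hyo := hb'.of_mem hy
  push Not at hxy hmin hmin'
  refine hxy.2.1 (ext fun z => ⟨fun hz => ?_, fun hz => ?_⟩)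
  · rcases hmin z (ha'.1 x hx z hz) hz y hy with h | rfl | h
    · exact h
    · exact absurd hz hxy.2.2
    · exact absurd (hxo.1 z hz y h) hxy.2.2
  · rcases hmin' z (hb'.1 y hy z hz) hz with h | rfl | h
    · exact absurd (hyo.1 z hz x h) hxy.1
    · exact absurd hz hxy.1
    · exact h

theorem IsOrdinal.subset_of_not_mem {a b : M} (ha : IsOrdinal a) (hb : IsOrdinal b)
    (h : ¬ b ∈ₛ a) : Subset a b := by
  rcases ha.trichotomy hb with h' | rfl | h'
  · exact hb.1 a h'
  · exact Subset.refl a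
  · exact absurd h' h

theorem IsOrdinal.subset_total {a b : M} (ha : IsOrdinal a) (hb : IsOrdinal b) :
    Subset a b ∨ Subset b a := by
  by_cases h : b ∈ₛ a
  · exact .inr (ha.1 b h)
  · exact .inl (ha.subset_of_not_mem hb h)

/-- All elements of `a` are ordinals. -/
def IsOrdSet (a : M) : Prop := ∀ x, x ∈ₛ a → IsOrdinal x

theorem IsOrdinal.isOrdSet {a : M} (ha : IsOrdinal a) : IsOrdSet a := fun _ => ha.of_mem

theorem IsOrdSet.mono {a b : M} (hb : IsOrdSet b) (h : Subset a b) : IsOrdSet a :=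
  fun x hx => hb x (h x hx)

theorem IsOrdSet.isOrdinal_sU {a : M} (ha : IsOrdSet a) : IsOrdinal (sU a) := by
  refine ⟨fun y hy z hz => ?_, fun y hy => ?_⟩
  · obtain ⟨x, hx, hyx⟩ := mem_sU.1 hy
    exact mem_sU.2 ⟨x, hx, (ha x hx).1 y hyx z hz⟩
  · obtain ⟨x, hx, hyx⟩ := mem_sU.1 hy
    exact (ha x hx).2 y hyx

theorem IsOrdinal.un {a b : M} (ha : IsOrdinal a) (hb : IsOrdinal b) : IsOrdinal (un a b) :=
  IsOrdSet.isOrdinal_sU fun x hx => by rcases mem_upair.1 hx with rfl | rfl <;> assumption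

theorem subset_un_left (a b : M) : Subset a (un a b) := fun _ h => mem_un.2 (.inl h)

theorem subset_un_right (a b : M) : Subset b (un a b) := fun _ h => mem_un.2 (.inr h)

theorem adj_self_inj {a b : M} (h : adj a a = adj b b) : a = b := by
  have h1 : a ∈ₛ adj b b := h ▸ mem_adj.2 (.inr rfl)
  have h2 : b ∈ₛ adj a a := h ▸ mem_adj.2 (.inr rfl)
  rcases mem_adj.1 h1 with h1 | h1
  · rcases mem_adj.1 h2 with h2 | h2
    · exact absurd h2 (mem_asymm h1)
    · exact h2.symm
  · exact h1

theorem adj_ne_emp (a b : M) : adj a b ≠ emp := fun h =>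
  not_mem_emp b (h ▸ mem_adj.2 (.inr rfl))

/-- A finite subset of the union of a chain of ordinals is contained in a member of the chain. -/
theorem IsFinite.exists_subset {a D : M} (ha : IsFinite a) (hD : IsOrdSet D)
    (hne : ∃ d, d ∈ₛ D) (h : Subset a (sU D)) : ∃ d, d ∈ₛ D ∧ Subset a d := by
  obtain ⟨w, n, f, hw, hn, hf, hinj⟩ := ha
  -- Induction on m treats the elements of `a` whose index under the injection `f` is below m. At
  -- each step the larger of two chain members is taken.
  have key := omega_induction hw
    (fun m => ∃ d, d ∈ₛ D ∧ ∀ x, x ∈ₛ a → ∀ k, k ∈ₛ m → opair x k ∈ₛ f → x ∈ₛ d)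
    ?_ ?_ n hn
  · obtain ⟨d, hd, hd'⟩ := key
    exact ⟨d, hd, fun x hx => hd' x hx _ (hf.app_mem hx).2 (hf.app_mem hx).1⟩
  · obtain ⟨d, hd⟩ := hne
    exact ⟨d, hd, fun x _ k hk => absurd hk (not_mem_emp k)⟩
  · rintro m - ⟨d, hd, hd'⟩
    by_cases hm : ∃ x, x ∈ₛ a ∧ opair x m ∈ₛ f
    · obtain ⟨x, hx, hxm⟩ := hm
      obtain ⟨d₁, hd₁, hxd₁⟩ := mem_sU.1 (h x hx)
      have key : ∀ e, Subset d e → Subset d₁ e →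
          ∀ y, y ∈ₛ a → ∀ k, k ∈ₛ adj m m → opair y k ∈ₛ f → y ∈ₛ e := by
        intro e he he₁ y hy k hk hyk
        rcases mem_adj.1 hk with hk | rfl
        · exact he y (hd' y hy k hk hyk)
        · exact hinj x y k hxm hyk ▸ he₁ x hxd₁
      rcases (hD d hd).subset_total (hD d₁ hd₁) with hs | hs
      · exact ⟨d₁, hd₁, key d₁ hs (Subset.refl _)⟩
      · exact ⟨d, hd, key d (Subset.refl _) hs⟩
    · refine ⟨d, hd, fun x hx k hk hxk => ?_⟩
      rcases mem_adj.1 hk with hk | rfl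
      · exact hd' x hx k hk hxk
      · exact absurd ⟨x, hx, hxk⟩ hm

/-! ### Sets of ordinals as linear orders -/

/-- The membership relation on `a`. -/
noncomputable def memRel (a : M) : M :=
  bU a fun x => bU a fun y => cset (x ∈ₛ y) (upair (opair x y) (opair x y)) emp

/-- The set `a` ordered by membership. -/
noncomputable def ordX (a : M) : M := opair a (memRel a)

/-- The identity function on `a`. -/
noncomputable def idm (a : M) : M := bU a fun x => upair (opair x x) (opair x x)

instance instPRIdm {f : (ℕ → M) → M} [PR B f] : PR B (fun v => idm (f v)) := by
  unfold idm; infer_instance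

instance instPROrdX {f : (ℕ → M) → M} [PR B f] : PR B (fun v => ordX (f v)) :=
  PR.comp1 (op := ordX) (by unfold ordX memRel; infer_instance)

theorem mem_memRel {a p : M} :
    p ∈ₛ memRel a ↔ ∃ x y, x ∈ₛ a ∧ y ∈ₛ a ∧ x ∈ₛ y ∧ p = opair x y := by
  simp only [memRel, mem_bU (fun _ => bU _ _), mem_bU (fun _ => cset _ _ _), mem_cset, mem_upair,
    not_mem_emp, and_false, or_false, or_self]
  constructor
  · rintro ⟨x, hx, y, hy, h, rfl⟩; exact ⟨x, y, hx, hy, h, rfl⟩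
  · rintro ⟨x, y, hx, hy, h, rfl⟩; exact ⟨x, hx, y, hy, h, rfl⟩

theorem opair_mem_memRel {a x y : M} :
    opair x y ∈ₛ memRel a ↔ x ∈ₛ a ∧ y ∈ₛ a ∧ x ∈ₛ y := by
  rw [mem_memRel]
  constructor
  · rintro ⟨x', y', hx, hy, h, e⟩
    obtain ⟨rfl, rfl⟩ := opair_inj e
    exact ⟨hx, hy, h⟩
  · exact fun h => ⟨x, y, h.1, h.2.1, h.2.2, rfl⟩

theorem mem_idm {a p : M} : p ∈ₛ idm a ↔ ∃ x, x ∈ₛ a ∧ p = opair x x := by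
  simp [idm, mem_bU, mem_upair]

theorem opair_mem_idm {a x y : M} : opair x y ∈ₛ idm a ↔ x ∈ₛ a ∧ y = x := by
  rw [mem_idm]
  constructor
  · rintro ⟨z, hz, e⟩
    obtain ⟨rfl, rfl⟩ := opair_inj e
    exact ⟨hz, rfl⟩
  · rintro ⟨h, rfl⟩; exact ⟨y, h, rfl⟩

theorem lt_ordX {a s t : M} : Lt (ordX a) s t ↔ s ∈ₛ a ∧ t ∈ₛ a ∧ s ∈ₛ t := by
  rw [lt_iff, ordX]
  simp [opair_mem_memRel]

theorem elem_ordX {a s : M} : Elem s (ordX a) ↔ s ∈ₛ a := by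
  rw [elem_iff, ordX]
  simp

theorem IsOrdSet.isLinearOrder {a : M} (ha : IsOrdSet a) : IsLinearOrder (ordX a) := by
  refine ⟨a, memRel a, rfl, fun p hp => ?_, fun s hs => ?_, fun s t q hst htq => ?_,
    fun s t hs ht => ?_⟩
  · obtain ⟨x, y, hx, hy, -, rfl⟩ := mem_memRel.1 hp
    exact ⟨x, y, hx, hy, rfl⟩
  · exact mem_irrefl s (opair_mem_memRel.1 hs).2.2
  · rw [opair_mem_memRel] at hst htq ⊢
    exact ⟨hst.1, htq.2.1, (ha q htq.2.1).1 t htq.2.2 s hst.2.2⟩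
  · rw [opair_mem_memRel, opair_mem_memRel]
    exact ((ha s hs).trichotomy (ha t ht)).imp (fun h => ⟨hs, ht, h⟩)
      (fun h => h.imp_right fun h => ⟨ht, hs, h⟩)

theorem IsOrdSet.isWellOrder {a : M} (ha : IsOrdSet a) : IsWellOrder (ordX a) := by
  refine ⟨ha.isLinearOrder, a, memRel a, rfl, fun s _ hne => ?_⟩
  obtain ⟨x, hx, hmin⟩ := regularity s hne
  exact ⟨x, hx, fun y hy h => hmin y hy (opair_mem_memRel.1 h).2.2⟩

theorem isEmbedding_idm {a b : M} (h : Subset a b) : IsEmbedding (idm a) (ordX a) (ordX b) := by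
  refine ⟨⟨a, _, b, _, rfl, rfl, fun p hp => ?_, fun x hx => ?_⟩, fun x x' y y' hy hy' hlt => ?_⟩
  · obtain ⟨x, hx, rfl⟩ := mem_idm.1 hp
    exact ⟨x, x, hx, h x hx, rfl⟩
  · exact ⟨x, opair_mem_idm.2 ⟨hx, rfl⟩, fun y hy => (opair_mem_idm.1 hy).2⟩
  · obtain ⟨-, rfl⟩ := opair_mem_idm.1 hy
    obtain ⟨-, rfl⟩ := opair_mem_idm.1 hy'
    rw [lt_ordX] at hlt ⊢
    exact ⟨h _ hlt.1, h _ hlt.2.1, hlt.2.2⟩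

theorem isComposition_idm {a b : M} (h : Subset a b) : IsComposition (idm a) (idm b) (idm a) := by
  intro p
  rw [mem_idm]
  constructor
  · rintro ⟨x, hx, rfl⟩
    exact ⟨x, x, x, opair_mem_idm.2 ⟨hx, rfl⟩, opair_mem_idm.2 ⟨h x hx, rfl⟩, rfl⟩
  · rintro ⟨x, y, z, hxy, hyz, rfl⟩
    obtain ⟨hx, rfl⟩ := opair_mem_idm.1 hxy
    obtain ⟨-, rfl⟩ := opair_mem_idm.1 hyz
    exact ⟨_, hx, rfl⟩

theorem IsSuborder.eq_ordX {Y a b : M} (h : IsSuborder Y a (ordX b)) : Y = ordX a := by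
  obtain ⟨ha, r, rfl, hr⟩ := h
  rw [ordX]
  congr 1
  refine ext fun p => ?_
  rw [hr, mem_memRel]
  refine exists_congr fun s => exists_congr fun t => and_congr_right fun hs =>
    and_congr_right fun ht => and_congr_left fun _ => ?_
  rw [lt_ordX]
  exact ⟨fun h => h.2.2, fun h => ⟨elem_ordX.1 (ha s hs), elem_ordX.1 (ha t ht), h⟩⟩

theorem IsIdentity.eq_idm {i a : M} (h : IsIdentity i (ordX a)) : i = idm a :=
  ext fun p => (h p).trans <| by simp only [elem_ordX, mem_idm]

end Ordinals

/-! ### Dilators on sets of ordinals -/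

section Linear

variable {M : Type u} [PRSetModel M] {X : M}

theorem IsLinearOrder.eq_opair (hX : IsLinearOrder X) : X = opair (fst X) (snd X) := by
  obtain ⟨c, r, rfl, -⟩ := hX
  simp

theorem IsLinearOrder.lt_irrefl (hX : IsLinearOrder X) (s : M) : ¬ Lt X s s := by
  obtain ⟨c, r, rfl, -, h, -⟩ := hX
  rw [lt_iff]
  simpa using h s

theorem IsLinearOrder.lt_trans (hX : IsLinearOrder X) {s t q : M} (h : Lt X s t) (h' : Lt X t q) :
    Lt X s q := by
  obtain ⟨c, r, rfl, -, -, h3, -⟩ := hX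
  rw [lt_iff] at h h' ⊢
  simp only [fst_opair, snd_opair, true_and] at h h' ⊢
  exact h3 s t q h h'

theorem IsLinearOrder.lt_trichotomy (hX : IsLinearOrder X) {s t : M} (hs : s ∈ₛ fst X)
    (ht : t ∈ₛ fst X) : Lt X s t ∨ s = t ∨ Lt X t s := by
  obtain ⟨c, r, rfl, -, -, -, h4⟩ := hX
  simp only [lt_iff, fst_opair, snd_opair, true_and] at hs ht ⊢
  exact h4 s t hs ht

theorem IsLinearOrder.elem_iff (hX : IsLinearOrder X) {s : M} : Elem s X ↔ s ∈ₛ fst X := by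
  rw [BachmannHoward.elem_iff, and_iff_right hX.eq_opair]

theorem IsOrdFun.isFun {f X Y : M} (h : IsOrdFun f X Y) : IsFun f (fst X) (fst Y) := by
  obtain ⟨c, r, d, s, rfl, rfl, h⟩ := h
  simpa using h

end Linear

namespace DilatorCode

variable {M : Type u} [PRSetModel M] {B : M → Prop} (T : DilatorCode) (p : M)

/-- The order `T_a`, for a set of ordinals `a`. -/
noncomputable def ordObj (a : M) : M := T.objAt p (ordX a)

/-- The underlying set of `T_a`. -/
noncomputable def car (a : M) : M := fst (T.ordObj p a)

/-- The function `T_a → T_b` induced by the inclusion of `a` into `b`. -/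
noncomputable def lift (a b σ : M) : M := app (T.mapAt p (ordX a) (ordX b) (idm a)) σ

/-- The support function of `T_a`. -/
noncomputable def spt (a σ : M) : M := T.suppAt p (ordX a) σ

/-- The comparison of `x ∈ T_a` and `y ∈ T_b` in `T_{a ∪ b}`. -/
def CodeLt (a x b y : M) : Prop :=
  Lt (T.ordObj p (un a b)) (T.lift p a (un a b) x) (T.lift p b (un a b) y)

section Instances

variable {f g h k : (ℕ → M) → M} [PR B (fun _ => p)] [PR B f] [PR B g] [PR B h] [PR B k]

instance instPROrdObj : PR B (fun v => T.ordObj p (f v)) := by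
  unfold ordObj objAt; infer_instance

instance instPRCar : PR B (fun v => T.car p (f v)) := by
  unfold car; infer_instance

instance instPRLift : PR B (fun v => T.lift p (f v) (g v) (h v)) := by
  unfold lift mapAt; infer_instance

instance instPRSpt : PR B (fun v => T.spt p (f v) (g v)) := by
  unfold spt suppAt; infer_instance

instance instPRPCodeLt : PRP B (fun v => T.CodeLt p (f v) (g v) (h v) (k v)) := by
  unfold CodeLt; infer_instance

end Instances

variable {T p}

namespace IsPraeDilator

variable (hT : T.IsPraeDilator p) {a b c : M}

include hT

theorem ordObj_linear (ha : IsOrdSet a) : IsLinearOrder (T.ordObj p a) :=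
  hT.obj_linear _ ha.isLinearOrder

theorem map_embedding' (hb : IsOrdSet b) (hab : Subset a b) :
    IsEmbedding (T.mapAt p (ordX a) (ordX b) (idm a)) (T.ordObj p a) (T.ordObj p b) :=
  hT.map_embedding _ _ _ (hb.mono hab).isLinearOrder hb.isLinearOrder (isEmbedding_idm hab)

theorem opair_lift (hb : IsOrdSet b) (hab : Subset a b) {σ : M} (hσ : σ ∈ₛ T.car p a) :
    opair σ (T.lift p a b σ) ∈ₛ T.mapAt p (ordX a) (ordX b) (idm a) :=
  ((hT.map_embedding' hb hab).1.isFun.app_mem hσ).1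

theorem lift_mem (hb : IsOrdSet b) (hab : Subset a b) {σ : M} (hσ : σ ∈ₛ T.car p a) :
    T.lift p a b σ ∈ₛ T.car p b :=
  ((hT.map_embedding' hb hab).1.isFun.app_mem hσ).2

theorem lift_lt (hb : IsOrdSet b) (hab : Subset a b) {σ τ : M} (hσ : σ ∈ₛ T.car p a)
    (hτ : τ ∈ₛ T.car p a) (h : Lt (T.ordObj p a) σ τ) :
    Lt (T.ordObj p b) (T.lift p a b σ) (T.lift p a b τ) :=
  (hT.map_embedding' hb hab).2 _ _ _ _ (hT.opair_lift hb hab hσ) (hT.opair_lift hb hab hτ) h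

/-- Embeddings are only required to preserve the order; reflection follows from linearity of both
sides. -/
theorem lift_lt_iff (hb : IsOrdSet b) (hab : Subset a b) {σ τ : M} (hσ : σ ∈ₛ T.car p a)
    (hτ : τ ∈ₛ T.car p a) :
    Lt (T.ordObj p b) (T.lift p a b σ) (T.lift p a b τ) ↔ Lt (T.ordObj p a) σ τ := by
  refine ⟨fun h => ?_, hT.lift_lt hb hab hσ hτ⟩
  have hlin := hT.ordObj_linear hb
  rcases (hT.ordObj_linear (hb.mono hab)).lt_trichotomy hσ hτ with h' | rfl | h'
  · exact h'
  · exact absurd h (hlin.lt_irrefl _)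
  · exact absurd (hlin.lt_trans h (hT.lift_lt hb hab hτ hσ h')) (hlin.lt_irrefl _)

theorem map_comp' (hc : IsOrdSet c) (hab : Subset a b) (hbc : Subset b c) :
    IsComposition (T.mapAt p (ordX a) (ordX c) (idm a)) (T.mapAt p (ordX b) (ordX c) (idm b))
      (T.mapAt p (ordX a) (ordX b) (idm a)) :=
  hT.map_comp _ _ _ _ _ _ (hc.mono (hab.trans hbc)).isLinearOrder (hc.mono hbc).isLinearOrder
    hc.isLinearOrder (isEmbedding_idm hab) (isEmbedding_idm hbc) (isComposition_idm hab)

theorem lift_lift (hc : IsOrdSet c) (hab : Subset a b) (hbc : Subset b c) {σ : M}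
    (hσ : σ ∈ₛ T.car p a) : T.lift p b c (T.lift p a b σ) = T.lift p a c σ := by
  have hb := hc.mono hbc
  refine ((hT.map_embedding' hc (hab.trans hbc)).1.isFun.app_eq
    ((hT.map_comp' hc hab hbc _).2 ⟨σ, _, _, hT.opair_lift hb hab hσ,
      hT.opair_lift hc hbc (hT.lift_mem hb hab hσ), rfl⟩)).symm

theorem spt_lift (hb : IsOrdSet b) (hab : Subset a b) {σ : M} (hσ : σ ∈ₛ T.car p a) :
    T.spt p b (T.lift p a b σ) = T.spt p a σ := by
  have hlin := (hb.mono hab).isLinearOrder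
  refine ext fun y => (hT.supp_natural _ _ _ _ _ hlin hb.isLinearOrder (isEmbedding_idm hab)
    (hT.opair_lift hb hab hσ) y).trans ⟨?_, fun hy => ⟨y, hy, opair_mem_idm.2 ⟨?_, rfl⟩⟩⟩
  · rintro ⟨x, hx, hxy⟩
    rwa [(opair_mem_idm.1 hxy).2]
  · exact elem_ordX.1 ((hT.supp_finite _ σ hlin
      ((hT.ordObj_linear (hb.mono hab)).elem_iff.2 hσ)).2 y hy)

theorem spt_finite (ha : IsOrdSet a) {σ : M} (hσ : σ ∈ₛ T.car p a) : IsFinite (T.spt p a σ) :=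
  (hT.supp_finite _ σ ha.isLinearOrder ((hT.ordObj_linear ha).elem_iff.2 hσ)).1

theorem spt_subset (ha : IsOrdSet a) {σ : M} (hσ : σ ∈ₛ T.car p a) : Subset (T.spt p a σ) a :=
  fun y hy => elem_ordX.1
    ((hT.supp_finite _ σ ha.isLinearOrder ((hT.ordObj_linear ha).elem_iff.2 hσ)).2 y hy)

/-- By the support condition, `τ` comes from T applied to its support. The inclusion of the support
into `b` factors through `a`, and functoriality supplies the preimage. -/
theorem exists_lift (hb : IsOrdSet b) (hab : Subset a b) {τ : M} (hτ : τ ∈ₛ T.car p b)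
    (h : Subset (T.spt p b τ) a) : ∃ σ, σ ∈ₛ T.car p a ∧ T.lift p a b σ = τ := by
  obtain ⟨Y, i, hY, hi, σ₀, hσ₀⟩ := hT.supp_range _ τ hb.isLinearOrder
    ((hT.ordObj_linear hb).elem_iff.2 hτ)
  obtain rfl := hY.eq_ordX
  obtain rfl := hi.eq_idm
  obtain ⟨x, y, z, hxy, hyz, e⟩ := (hT.map_comp' hb h hab _).1 hσ₀
  obtain ⟨rfl, rfl⟩ := opair_inj e
  have hf := (hT.map_embedding' hb hab).1.isFun
  obtain ⟨y', z', hy', -, e'⟩ := hf.1 _ hyz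
  rw [← (opair_inj e').1] at hy'
  exact ⟨y, hy', hf.app_eq hyz⟩

/-- Comparison in T_{a ∪ b} agrees with comparison in T_c for any larger c. This makes the order on
codes the restriction of a single linear order. -/
theorem codeLt_iff (hc : IsOrdSet c) (hac : Subset a c) (hbc : Subset b c) {σ τ : M}
    (hσ : σ ∈ₛ T.car p a) (hτ : τ ∈ₛ T.car p b) :
    T.CodeLt p a σ b τ ↔ Lt (T.ordObj p c) (T.lift p a c σ) (T.lift p b c τ) := by
  have hun : Subset (un a b) c := fun x hx => (mem_un.1 hx).elim (hac x) (hbc x)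
  have hun' := hc.mono hun
  rw [← hT.lift_lift hc (subset_un_left a b) hun hσ, ← hT.lift_lift hc (subset_un_right a b) hun hτ,
    hT.lift_lt_iff hc hun (hT.lift_mem hun' (subset_un_left a b) hσ)
      (hT.lift_mem hun' (subset_un_right a b) hτ)]
  rfl

end IsPraeDilator

end DilatorCode

/-! ### The collapse on the height of an admissible set -/

section Height

variable {M : Type u} [PRSetModel M]

/-- The height `A ∩ Ord` of `A`. -/
noncomputable def height (A : M) : M := sep A IsOrdinal

theorem mem_height {A x : M} : x ∈ₛ height A ↔ x ∈ₛ A ∧ IsOrdinal x := mem_sep _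

theorem isOrdSet_height (A : M) : IsOrdSet (height A) := fun _ hx => (mem_height.1 hx).2

theorem subset_height {A a : M} [Admissible A] (ha : a ∈ₛ height A) : Subset a (height A) :=
  fun _ hx => mem_height.2 ⟨Admissible.trans (mem_height.1 ha).1 hx, (mem_height.1 ha).2.of_mem hx⟩

/-- A is closed under successors, so its height is a limit; finite subsets of the height are
therefore contained in one of its elements. -/
theorem subset_sU_height {A : M} [Admissible A] : Subset (height A) (sU (height A)) := by
  intro x hx
  rw [mem_height] at hx
  exact mem_sU.2 ⟨adj x x, mem_height.2 ⟨adj_mem_A hx.1 hx.1, isOrdinal_adj hx.2⟩,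
    mem_adj.2 (.inr rfl)⟩

theorem right_mem_sU_sU {x y g : M} (h : opair x y ∈ₛ g) : y ∈ₛ sU (sU g) := by
  obtain ⟨z, hz, hyz⟩ := mem_sU.1 (right_mem_sU x y)
  exact mem_sU.2 ⟨z, mem_sU.2 ⟨_, h, hz⟩, hyz⟩

theorem left_mem_of_opair {A x y : M} [Admissible A] (h : opair x y ∈ₛ A) : x ∈ₛ A := by
  obtain ⟨z, hz, hxz⟩ := mem_sU.1 (left_mem_sU x y)
  exact Admissible.trans (Admissible.trans h hz) hxz

theorem right_mem_of_opair {A x y : M} [Admissible A] (h : opair x y ∈ₛ A) : y ∈ₛ A := by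
  obtain ⟨z, hz, hyz⟩ := mem_sU.1 (right_mem_sU x y)
  exact Admissible.trans (Admissible.trans h hz) hyz

end Height

namespace DilatorCode

variable {M : Type u} [PRSetModel M] {B : M → Prop} (T : DilatorCode) (p : M)

/-- The ordinal `ξ` is the collapse of the code `(a, σ)`, relative to the values in `g`. -/
def Step (g a σ ξ : M) : Prop :=
  Subset (T.spt p a σ) ξ ∧
  (∀ ρ, ρ ∈ₛ T.car p ξ → T.CodeLt p ξ ρ a σ → ∃ η, η ∈ₛ ξ ∧ opair (opair ξ ρ) η ∈ₛ g) ∧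
  -- Minimality of ξ is expressed by a counterexample to the closure of ζ, so that `g` occurs only
  -- positively.
  ∀ ζ, ζ ∈ₛ ξ → Subset (T.spt p a σ) ζ → ∃ ρ, ρ ∈ₛ T.car p ξ ∧ Subset (T.spt p ξ ρ) ζ ∧
    T.CodeLt p ξ ρ a σ ∧ ∃ η, η ∈ₛ ξ ∧ opair (opair ξ ρ) η ∈ₛ g ∧ ¬ η ∈ₛ ζ

/-- The set `g` is a partial collapse: it consists of triples `((a, σ), ξ)` such that `ξ` is the
collapse of `(a, σ)` relative to `g`. -/
def PartialCollapse (g : M) : Prop :=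
  ∀ q, q ∈ₛ g → q = opair (opair (fst (fst q)) (snd (fst q))) (snd q) ∧
    IsOrdinal (fst (fst q)) ∧ snd (fst q) ∈ₛ T.car p (fst (fst q)) ∧ IsOrdinal (snd q) ∧
    T.Step p g (fst (fst q)) (snd (fst q)) (snd q)

/-- The partial collapse `g` is defined on all `(b, ρ)` below `(a, σ)`. -/
def Covers (a σ g b : M) : Prop :=
  T.PartialCollapse p g ∧ ∀ ρ, ρ ∈ₛ T.car p b → T.CodeLt p b ρ a σ →
    -- The double union serves as a bound for η, which keeps the predicate primitive recursive.
    ∃ η, η ∈ₛ sU (sU g) ∧ opair (opair b ρ) η ∈ₛ g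

/-- The least ordinal above `b` and above all values `g (b, ρ)` with `(b, ρ)` below `(a, σ)`. -/
noncomputable def next (a σ g b : M) : M :=
  un b (bU (sep g fun q => fst (fst q) = b ∧ T.CodeLt p b (snd (fst q)) a σ)
    fun q => adj (snd q) (snd q))

/-- The set `f` consists of triples `(m, (b, g))` such that `b` is the `m`-th iterate of the
function `next`, starting with `a`. -/
def Chain (w a σ f : M) : Prop :=
  ∀ q, q ∈ₛ f → (fst q ∈ₛ w ∧ IsOrdinal (fst (snd q)) ∧
    T.Covers p a σ (snd (snd q)) (fst (snd q))) ∧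
    (fst q = emp ∧ fst (snd q) = a ∨ ∃ q', q' ∈ₛ f ∧ fst q = adj (fst q') (fst q') ∧
      fst (snd q) = T.next p a σ (snd (snd q')) (fst (snd q')))

/-- The ordinal `ξ` is the collapse of `s ∈ T_{o(A)}` according to some partial collapse
in `A`. -/
def Val (A s ξ : M) : Prop :=
  ∃ g, g ∈ₛ A ∧ T.PartialCollapse p g ∧ ∃ a, a ∈ₛ height A ∧ ∃ σ, σ ∈ₛ T.car p a ∧
    T.lift p a (height A) σ = s ∧ opair (opair a σ) ξ ∈ₛ g

section Instances

variable {f g h k l : (ℕ → M) → M} [hp : PR B (fun _ => p)] [PR B f] [PR B g] [PR B h] [PR B k]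

instance instPRPStep : PRP B (fun v => T.Step p (f v) (g v) (h v) (k v)) :=
  PRP.comp4 (op := T.Step p) (by unfold Step; infer_instance)

instance instPRPPartialCollapse : PRP B (fun v => T.PartialCollapse p (f v)) :=
  PRP.comp1 (op := T.PartialCollapse p) (by unfold PartialCollapse; infer_instance)

instance instPRPCovers : PRP B (fun v => T.Covers p (f v) (g v) (h v) (k v)) :=
  PRP.comp4 (op := T.Covers p) (by unfold Covers; infer_instance)

instance instPRNext : PR B (fun v => T.next p (f v) (g v) (h v) (k v)) :=
  PR.comp4 (op := T.next p) (by unfold next; infer_instance)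

instance instPRPChain : PRP B (fun v => T.Chain p (f v) (g v) (h v) (k v)) :=
  PRP.comp4 (op := T.Chain p) (by unfold Chain; infer_instance)

/-- Quantifiers over A are bounded from the viewpoint of M, where A is a parameter. Thus M can do
induction on statements about values, while A itself could not use this predicate as it stands. -/
instance instPRPVal (A : M) {f g : (ℕ → M) → M} [PR Any f] [PR Any g] :
    PRP Any (fun v => T.Val p A (f v) (g v)) :=
  PRP.comp2 (op := T.Val p A) (by unfold Val; infer_instance)

end Instances

variable {T p}

/-- `Step` is positive in `g`. Consequently partial collapses can be united and extended without a
prior proof that they agree. -/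
theorem Step.mono {g g' a σ ξ : M} (h : T.Step p g a σ ξ) (hg : Subset g g') :
    T.Step p g' a σ ξ := by
  obtain ⟨h1, h2, h3⟩ := h
  refine ⟨h1, fun ρ hρ hlt => ?_, fun ζ hζ hs => ?_⟩
  · obtain ⟨η, hη, h⟩ := h2 ρ hρ hlt
    exact ⟨η, hη, hg _ h⟩
  · obtain ⟨ρ, hρ, hs', hlt, η, hη, h, hηζ⟩ := h3 ζ hζ hs
    exact ⟨ρ, hρ, hs', hlt, η, hη, hg _ h, hηζ⟩

theorem PartialCollapse.step {g a σ ξ : M} (hg : T.PartialCollapse p g)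
    (h : opair (opair a σ) ξ ∈ₛ g) :
    IsOrdinal a ∧ σ ∈ₛ T.car p a ∧ IsOrdinal ξ ∧ T.Step p g a σ ξ := by
  simpa using (hg _ h).2

theorem partialCollapse_emp : T.PartialCollapse p (emp : M) := fun q hq => absurd hq (not_mem_emp q)

theorem PartialCollapse.sU {b : M} (hb : ∀ g, g ∈ₛ b → T.PartialCollapse p g) :
    T.PartialCollapse p (sU b) := by
  intro q hq
  obtain ⟨g, hg, hqg⟩ := mem_sU.1 hq
  obtain ⟨h1, h2, h3, h4, h5⟩ := hb g hg q hqg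
  exact ⟨h1, h2, h3, h4, h5.mono fun t ht => mem_sU.2 ⟨g, hg, ht⟩⟩

theorem PartialCollapse.adj {g a σ ξ : M} (hg : T.PartialCollapse p g) (ha : IsOrdinal a)
    (hσ : σ ∈ₛ T.car p a) (hξ : IsOrdinal ξ) (h : T.Step p g a σ ξ) :
    T.PartialCollapse p (adj g (opair (opair a σ) ξ)) := by
  have hs : Subset g (BachmannHoward.adj g (opair (opair a σ) ξ)) := fun t ht => mem_adj.2 (.inl ht)
  intro q hq
  rcases mem_adj.1 hq with hq | rfl
  · obtain ⟨h1, h2, h3, h4, h5⟩ := hg q hq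
    exact ⟨h1, h2, h3, h4, h5.mono hs⟩
  · simpa using ⟨ha, hσ, hξ, h.mono hs⟩

/-! ### Values of the collapse and their uniqueness -/

section Collapse

variable {A : M} [hA : Admissible A]

theorem PartialCollapse.mem_height {g a σ ξ : M} (hg : T.PartialCollapse p g) (hgA : g ∈ₛ A)
    (h : opair (opair a σ) ξ ∈ₛ g) :
    a ∈ₛ height A ∧ σ ∈ₛ T.car p a ∧ ξ ∈ₛ height A ∧ T.Step p g a σ ξ := by
  obtain ⟨h1, h2, h3, h4⟩ := hg.step h
  have h5 := Admissible.trans hgA h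
  exact ⟨BachmannHoward.mem_height.2 ⟨left_mem_of_opair (left_mem_of_opair h5), h1⟩, h2,
    BachmannHoward.mem_height.2 ⟨right_mem_of_opair h5, h3⟩, h4⟩

theorem PartialCollapse.val {g a σ ξ : M} (hg : T.PartialCollapse p g) (hgA : g ∈ₛ A)
    (h : opair (opair a σ) ξ ∈ₛ g) : T.Val p A (T.lift p a (height A) σ) ξ := by
  obtain ⟨h1, h2, -⟩ := hg.mem_height hgA h
  exact ⟨g, hgA, hg, a, h1, σ, h2, rfl, h⟩

theorem Val.mem_height {s ξ : M} (h : T.Val p A s ξ) : ξ ∈ₛ height A := by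
  obtain ⟨g, hg, hgc, a, ha, σ, hσ, rfl, h⟩ := h
  exact (hgc.mem_height hg h).2.2.1

theorem car_mem_A {b : M} (hp : p ∈ₛ A) (hb : b ∈ₛ A) : T.car p b ∈ₛ A := by
  have : PR (InA A) (fun _ => p) := PR.const hp
  have : PR (InA A) (fun _ => b) := PR.const hb
  exact mem_A _

section PraeDilator

variable (hT : T.IsPraeDilator p)

include hT

theorem spt_lift_height {a σ : M} (ha : a ∈ₛ height A) (hσ : σ ∈ₛ T.car p a) :
    T.spt p (height A) (T.lift p a (height A) σ) = T.spt p a σ :=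
  hT.spt_lift (isOrdSet_height A) (subset_height ha) hσ

theorem lift_mem_height {a σ : M} (ha : a ∈ₛ height A) (hσ : σ ∈ₛ T.car p a) :
    T.lift p a (height A) σ ∈ₛ T.car p (height A) :=
  hT.lift_mem (isOrdSet_height A) (subset_height ha) hσ

theorem codeLt_height {a b σ τ : M} (ha : a ∈ₛ height A) (hb : b ∈ₛ height A)
    (hσ : σ ∈ₛ T.car p a) (hτ : τ ∈ₛ T.car p b) :
    T.CodeLt p a σ b τ ↔ Lt (T.ordObj p (height A)) (T.lift p a (height A) σ)
      (T.lift p b (height A) τ) :=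
  hT.codeLt_iff (isOrdSet_height A) (subset_height ha) (subset_height hb) hσ hτ

theorem Val.spt_subset {s ξ : M} (h : T.Val p A s ξ) : Subset (T.spt p (height A) s) ξ := by
  obtain ⟨g, hg, hgc, a, ha, σ, hσ, rfl, h⟩ := h
  rw [spt_lift_height hT ha hσ]
  exact (hgc.mem_height hg h).2.2.2.1

/-- As the support of t lies in ξ, t has a code over ξ itself, and the closure clause of `Step`
speaks about exactly these codes. -/
theorem Val.exists_below {s ξ t : M} (h : T.Val p A s ξ) (ht : t ∈ₛ T.car p (height A))
    (hts : Lt (T.ordObj p (height A)) t s) (hsub : Subset (T.spt p (height A) t) ξ) :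
    ∃ η, η ∈ₛ ξ ∧ T.Val p A t η := by
  obtain ⟨g, hg, hgc, a, ha, σ, hσ, rfl, h⟩ := h
  obtain ⟨-, -, hξ, -, h2, -⟩ := hgc.mem_height hg h
  obtain ⟨ρ, hρ, rfl⟩ := hT.exists_lift (isOrdSet_height A) (subset_height hξ) ht hsub
  obtain ⟨η, hη, hηg⟩ := h2 ρ hρ ((codeLt_height hT hξ ha hρ hσ).2 hts)
  exact ⟨η, hη, hgc.val hg hηg⟩

theorem Val.minimal {s ξ ζ : M} (h : T.Val p A s ξ) (hζ : ζ ∈ₛ ξ)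
    (hsub : Subset (T.spt p (height A) s) ζ) : ∃ t, t ∈ₛ T.car p (height A) ∧
      Lt (T.ordObj p (height A)) t s ∧ Subset (T.spt p (height A) t) ζ ∧
      ∃ η, T.Val p A t η ∧ ¬ η ∈ₛ ζ := by
  obtain ⟨g, hg, hgc, a, ha, σ, hσ, rfl, h⟩ := h
  obtain ⟨-, -, hξ, -, -, h3⟩ := hgc.mem_height hg h
  rw [spt_lift_height hT ha hσ] at hsub
  obtain ⟨ρ, hρ, hs', hlt, η, hη, hηg, hηζ⟩ := h3 ζ hζ hsub
  refine ⟨T.lift p ξ (height A) ρ, lift_mem_height hT hξ hρ,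
    (codeLt_height hT hξ ha hρ hσ).1 hlt, ?_, η, hgc.val hg hηg, hηζ⟩
  rwa [spt_lift_height hT hξ hρ]

theorem Val.car {s ξ : M} (h : T.Val p A s ξ) : s ∈ₛ T.car p (height A) := by
  obtain ⟨g, hg, hgc, a, ha, σ, hσ, rfl, h⟩ := h
  exact lift_mem_height hT ha hσ

end PraeDilator

variable (hT : T.IsDilator p)

include hT

omit hA in
-- This is where the dilator property enters: the height is well-ordered by regularity, hence T of
-- the height is well-founded in M.
theorem car_induction (P : M → Prop) [PRP Any (fun v : ℕ → M => P (v 0))]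
    (h : ∀ s, s ∈ₛ T.car p (height A) → (∀ t, t ∈ₛ T.car p (height A) →
      Lt (T.ordObj p (height A)) t s → P t) → P s) : ∀ s, s ∈ₛ T.car p (height A) → P s := by
  obtain ⟨hlin, c, r, hX, hwf⟩ := hT.2 _ (isOrdSet_height A).isWellOrder
  have hX' : T.ordObj p (height A) = opair c r := hX
  have hc : T.car p (height A) = c := by rw [car, hX', fst_opair]
  rw [hc] at h ⊢
  refine wf_induction hwf P fun s hs ih => h s hs fun t ht hts => ih t ht ?_
  rw [hX', lt_iff, snd_opair] at hts
  exact hts.2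

/-- Suppose ξ' < ξ are both values of s. Minimality of ξ yields some t < s with support in ξ' and a
value outside ξ', while closure of ξ' yields a value of t inside ξ'. This contradicts the induction
hypothesis for t. -/
theorem Val.unique {s ξ ξ' : M} (h : T.Val p A s ξ) (h' : T.Val p A s ξ') : ξ = ξ' := by
  refine car_induction (A := A) hT (fun s => ∀ ξ, ξ ∈ₛ A → ∀ ξ', ξ' ∈ₛ A → T.Val p A s ξ →
    T.Val p A s ξ' → ξ = ξ') ?_ s (h.car hT.1) ξ (BachmannHoward.mem_height.1 h.mem_height).1
    ξ' (BachmannHoward.mem_height.1 h'.mem_height).1 h h'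
  intro s _ ih
  have key : ∀ ξ ξ', T.Val p A s ξ → T.Val p A s ξ' → ¬ ξ' ∈ₛ ξ := by
    intro ξ ξ' h h' hlt
    obtain ⟨t, ht, hts, hsub, η, hη, hη'⟩ := h.minimal hT.1 hlt (h'.spt_subset hT.1)
    obtain ⟨η', hη'ξ', hv⟩ := h'.exists_below hT.1 ht hts hsub
    obtain rfl := ih t ht hts η (BachmannHoward.mem_height.1 hη.mem_height).1 η'
      (BachmannHoward.mem_height.1 hv.mem_height).1 hη hv
    exact hη' hη'ξ'
  intro ξ _ ξ' _ h h'
  rcases (BachmannHoward.mem_height.1 h.mem_height).2.trichotomy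
    (BachmannHoward.mem_height.1 h'.mem_height).2 with hlt | rfl | hlt
  · exact absurd hlt (key _ _ h' h)
  · rfl
  · exact absurd hlt (key _ _ h h')

/-- `Step` depends on a code only through its support and its position among other codes, which are
determined by the element of T_{o(A)} that it represents. So the entry for one code can be copied to
any other code of this element. -/
theorem Val.exists_code {t η b ρ : M} (h : T.Val p A t η) (hb : b ∈ₛ height A)
    (hρ : ρ ∈ₛ T.car p b) (ht : T.lift p b (height A) ρ = t) (hp : p ∈ₛ A) :
    ∃ g, g ∈ₛ A ∧ T.PartialCollapse p g ∧ opair (opair b ρ) η ∈ₛ g := by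
  obtain ⟨g, hg, hgc, a, ha, σ, hσ, rfl, h⟩ := h
  obtain ⟨-, -, hη, hstep⟩ := hgc.mem_height hg h
  have hs : T.spt p b ρ = T.spt p a σ := by
    rw [← spt_lift_height hT.1 ha hσ, ← ht, spt_lift_height hT.1 hb hρ]
  have hlt : ∀ ρ', ρ' ∈ₛ T.car p η → (T.CodeLt p η ρ' b ρ ↔ T.CodeLt p η ρ' a σ) := by
    intro ρ' hρ'
    rw [codeLt_height hT.1 hη hb hρ' hρ, codeLt_height hT.1 hη ha hρ' hσ, ht]
  have hbA := BachmannHoward.mem_height.1 hb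
  have hηA := BachmannHoward.mem_height.1 hη
  have hcar : ρ ∈ₛ A := Admissible.trans (car_mem_A hp hbA.1) hρ
  refine ⟨BachmannHoward.adj g (opair (opair b ρ) η),
    adj_mem_A hg (opair_mem_A (opair_mem_A hbA.1 hcar) hηA.1),
    hgc.adj hbA.2 hρ hηA.2 ?_, mem_adj.2 (.inr rfl)⟩
  obtain ⟨h1, h2, h3⟩ := hstep
  refine ⟨hs ▸ h1, fun ρ' hρ' hl => h2 ρ' hρ' ((hlt ρ' hρ').1 hl), fun ζ hζ hsub => ?_⟩
  obtain ⟨ρ', hρ', hs', hl, h⟩ := h3 ζ hζ (hs ▸ hsub)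
  exact ⟨ρ', hρ', hs', (hlt ρ' hρ').2 hl, h⟩

end Collapse

end DilatorCode

namespace DilatorCode

variable {M : Type u} [PRSetModel M] {T : DilatorCode} {p A : M} [hA : Admissible A]

/-! ### Existence of values below the height -/

section Existence

variable (hT : T.IsDilator p) (hp : p ∈ₛ A) {a σ : M} (ha : a ∈ₛ height A) (hσ : σ ∈ₛ T.car p a)
  (ih : ∀ t, t ∈ₛ T.car p (height A) →
    Lt (T.ordObj p (height A)) t (T.lift p a (height A) σ) → ∃ ξ, T.Val p A t ξ)

include hT hp ha hσ

-- The induction hypothesis provides a partial collapse in A for each ρ separately. Collection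
-- applies since T_b ∈ A, and the union of the collected partial collapses covers all of T_b below
-- the given code.
include ih in
theorem exists_covers {b : M} (hb : b ∈ₛ height A) : ∃ g, g ∈ₛ A ∧ T.Covers p a σ g b := by
  have haA := (mem_height.1 ha).1
  have hbA := (mem_height.1 hb).1
  have hσA : σ ∈ₛ A := Admissible.trans (car_mem_A hp haA) hσ
  have : PR (InA A) (fun _ => p) := PR.const hp
  have : PR (InA A) (fun _ => a) := PR.const haA
  have : PR (InA A) (fun _ => b) := PR.const hbA
  have : PR (InA A) (fun _ => σ) := PR.const hσA
  have key : ∀ ρ, ρ ∈ₛ T.car p b → ∃ g, g ∈ₛ A ∧ T.PartialCollapse p g ∧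
      (T.CodeLt p b ρ a σ → ∃ η, η ∈ₛ sU (sU g) ∧ opair (opair b ρ) η ∈ₛ g) := by
    intro ρ hρ
    by_cases hlt : T.CodeLt p b ρ a σ
    · obtain ⟨ξ, hξ⟩ := ih _ (lift_mem_height hT.1 hb hρ) ((codeLt_height hT.1 hb ha hρ hσ).1 hlt)
      obtain ⟨g, hg, hgc, h⟩ := hξ.exists_code hT hb hρ rfl hp
      exact ⟨g, hg, hgc, fun _ => ⟨ξ, right_mem_sU_sU h, h⟩⟩
    -- Codes that are not below (a, σ) receive ∅ as a dummy, because collection needs a witness for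
    -- each ρ.
    · exact ⟨emp, emp_mem_A, partialCollapse_emp, fun h => absurd h hlt⟩
  obtain ⟨c, hc, h1, h2⟩ := pr_collection (car_mem_A hp hbA)
    (fun ρ g => T.PartialCollapse p g ∧ (T.CodeLt p b ρ a σ →
      ∃ η, η ∈ₛ sU (sU g) ∧ opair (opair b ρ) η ∈ₛ g)) key
  refine ⟨sU c, sU_mem_A hc, PartialCollapse.sU fun g hg => ?_, fun ρ hρ hlt => ?_⟩
  · obtain ⟨_, _, h, -⟩ := h2 g hg
    exact h
  · obtain ⟨g, hg, -, h⟩ := h1 ρ hρ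
    obtain ⟨η, -, hη⟩ := h hlt
    have : opair (opair b ρ) η ∈ₛ sU c := mem_sU.2 ⟨g, hg, hη⟩
    exact ⟨η, right_mem_sU_sU this, this⟩

omit hp ha hσ in
theorem Covers.mem_iff {b g ρ η : M} (hg : g ∈ₛ A)
    (h : T.Covers p a σ g b) (hρ : ρ ∈ₛ T.car p b) (hlt : T.CodeLt p b ρ a σ) :
    opair (opair b ρ) η ∈ₛ g ↔ T.Val p A (T.lift p b (height A) ρ) η := by
  refine ⟨h.1.val hg, fun hv => ?_⟩
  obtain ⟨η', -, hη'⟩ := h.2 ρ hρ hlt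
  exact hv.unique hT (h.1.val hg hη') ▸ hη'

omit hp ha hσ in
-- The right side does not mention `g`: by uniqueness of values, the iterates do not depend on the
-- chosen partial collapses.
theorem Covers.mem_next {b g t : M} (hg : g ∈ₛ A)
    (h : T.Covers p a σ g b) : t ∈ₛ T.next p a σ g b ↔ t ∈ₛ b ∨
      ∃ ρ η, ρ ∈ₛ T.car p b ∧ T.CodeLt p b ρ a σ ∧ T.Val p A (T.lift p b (height A) ρ) η ∧
        t ∈ₛ adj η η := by
  rw [next, mem_un, mem_bU]
  refine or_congr_right ⟨?_, ?_⟩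
  · rintro ⟨q, hq, ht⟩
    rw [mem_sep] at hq
    obtain ⟨hq, hqb, hlt⟩ := hq
    obtain ⟨e, -, hρ, -⟩ := h.1 q hq
    rw [hqb] at e hρ
    refine ⟨_, _, hρ, hlt, (h.mem_iff hT hg hρ hlt).1 ?_, ht⟩
    rwa [← e]
  · rintro ⟨ρ, η, hρ, hlt, hv, ht⟩
    refine ⟨_, (mem_sep _).2 ⟨(h.mem_iff hT hg hρ hlt).2 hv, ?_⟩, ?_⟩
    · simpa using hlt
    · simpa using ht

omit hp ha hσ in
theorem Covers.next_eq {b g g' : M} (hg : g ∈ₛ A) (hg' : g' ∈ₛ A)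
    (h : T.Covers p a σ g b) (h' : T.Covers p a σ g' b) :
    T.next p a σ g b = T.next p a σ g' b :=
  ext fun t => by rw [h.mem_next hT hg, h'.mem_next hT hg']

omit hT in
theorem Covers.next_mem_height {b g : M} (hb : b ∈ₛ height A) (hg : g ∈ₛ A)
    (h : T.Covers p a σ g b) : T.next p a σ g b ∈ₛ height A := by
  have haA := (mem_height.1 ha).1
  have hbA := (mem_height.1 hb).1
  have hσA : σ ∈ₛ A := Admissible.trans (car_mem_A hp haA) hσ
  have : PR (InA A) (fun _ => p) := PR.const hp
  have : PR (InA A) (fun _ => a) := PR.const haA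
  have : PR (InA A) (fun _ => b) := PR.const hbA
  have : PR (InA A) (fun _ => σ) := PR.const hσA
  have : PR (InA A) (fun _ => g) := PR.const hg
  refine mem_height.2 ⟨mem_A _, IsOrdinal.un (mem_height.1 hb).2 ?_⟩
  have key : ∀ q, q ∈ₛ sep g (fun q => fst (fst q) = b ∧ T.CodeLt p b (snd (fst q)) a σ) →
      IsOrdinal (adj (snd q) (snd q)) := fun q hq =>
    isOrdinal_adj (h.1 q ((mem_sep _).1 hq).1).2.2.2.1
  refine ⟨fun y hy z hz => ?_, fun y hy => ?_⟩ <;> rw [mem_bU] at *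
  · obtain ⟨q, hq, hyq⟩ := hy
    exact ⟨q, hq, (key q hq).1 y hyq z hz⟩
  · obtain ⟨q, hq, hyq⟩ := hy
    exact (key q hq).2 y hyq

omit hA hT hp ha hσ in
theorem Chain.mono_entry {w f f' q : M} (hf : T.Chain p w a σ f) (hff' : Subset f f')
    (hq : q ∈ₛ f) : (fst q ∈ₛ w ∧ IsOrdinal (fst (snd q)) ∧
    T.Covers p a σ (snd (snd q)) (fst (snd q))) ∧
    (fst q = emp ∧ fst (snd q) = a ∨ ∃ q', q' ∈ₛ f' ∧ fst q = adj (fst q') (fst q') ∧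
      fst (snd q) = T.next p a σ (snd (snd q')) (fst (snd q'))) := by
  obtain ⟨h1, h2⟩ := hf q hq
  exact ⟨h1, h2.imp_right fun ⟨q', hq', h⟩ => ⟨q', hff' _ hq', h⟩⟩

omit hA hT hp ha hσ in
theorem Chain.sU {w c : M} (hc : ∀ f, f ∈ₛ c → T.Chain p w a σ f) : T.Chain p w a σ (sU c) := by
  intro q hq
  obtain ⟨f, hf, hqf⟩ := mem_sU.1 hq
  exact (hc f hf).mono_entry (fun t ht => mem_sU.2 ⟨f, hf, ht⟩) hqf

omit hp ha hσ in
theorem Chain.unique {w f f' : M} (hw : IsOmega w)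
    (hf : T.Chain p w a σ f) (hf' : T.Chain p w a σ f')
    (hfA : ∀ q, q ∈ₛ f → snd (snd q) ∈ₛ A) (hfA' : ∀ q, q ∈ₛ f' → snd (snd q) ∈ₛ A) {q q' : M} (hq : q ∈ₛ f)
    (hq' : q' ∈ₛ f') (h : fst q = fst q') : fst (snd q) = fst (snd q') := by
  refine omega_induction hw (fun m => ∀ q, q ∈ₛ f → ∀ q', q' ∈ₛ f' → fst q = m → fst q' = m →
    fst (snd q) = fst (snd q')) ?_ ?_ (fst q) (hf q hq).1.1 q hq q' hq' rfl h.symm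
  · intro q hq q' hq' h h'
    rcases (hf q hq).2 with ⟨-, h1⟩ | ⟨r, -, h1, -⟩
    · rcases (hf' q' hq').2 with ⟨-, h2⟩ | ⟨r, -, h2, -⟩
      · rw [h1, h2]
      · exact absurd (h2.symm.trans h') (adj_ne_emp _ _)
    · exact absurd (h1.symm.trans h) (adj_ne_emp _ _)
  · intro m _ ihm q hq q' hq' h h'
    rcases (hf q hq).2 with ⟨h1, -⟩ | ⟨r, hr, h1, h2⟩
    · exact absurd (h.symm.trans h1) (adj_ne_emp _ _)
    rcases (hf' q' hq').2 with ⟨h1', -⟩ | ⟨r', hr', h1', h2'⟩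
    · exact absurd (h'.symm.trans h1') (adj_ne_emp _ _)
    have e := adj_self_inj (h1.symm.trans h)
    have e' := adj_self_inj (h1'.symm.trans h')
    have hb := ihm r hr r' hr' e e'
    have hc' := (hf' r' hr').1.2.2
    rw [← hb] at hc' h2'
    rw [h2, h2', (hf r hr).1.2.2.next_eq hT (hfA r hr) (hfA' r' hr') hc']

include ih in
/-- There is a sequence `b₀ = a, b₁, b₂, …` of ordinals in `A` with `b_{n + 1} = next b_n`. -/
theorem exists_chain : ∃ w f, IsOmega w ∧ f ∈ₛ A ∧ T.Chain p w a σ f ∧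
    ∀ m, m ∈ₛ w → ∃ q, q ∈ₛ f ∧ fst q = m := by
  obtain ⟨w, hw, hwA⟩ := hA.out.2.1
  have haA := (mem_height.1 ha).1
  have hσA : σ ∈ₛ A := Admissible.trans (car_mem_A hp haA) hσ
  have : PR (InA A) (fun _ => p) := PR.const hp
  have : PR (InA A) (fun _ => a) := PR.const haA
  have : PR (InA A) (fun _ => σ) := PR.const hσA
  have : PR (InA A) (fun _ => w) := PR.const hwA
  -- Finite chains of every length exist by induction on m. Each entry stores a partial collapse
  -- from which the next ordinal is computed; collection and union then merge all lengths into one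
  -- set.
  have key : ∀ m, m ∈ₛ w → ∃ f, f ∈ₛ A ∧ T.Chain p w a σ f ∧ ∃ q, q ∈ₛ f ∧ fst q = m := by
    refine omega_induction hw (fun m => ∃ f, f ∈ₛ A ∧ T.Chain p w a σ f ∧ ∃ q, q ∈ₛ f ∧ fst q = m)
      ?_ ?_
    · obtain ⟨g, hg, hgc⟩ := exists_covers hT hp ha hσ ih ha
      refine ⟨adj emp (opair emp (opair a g)), adj_mem_A emp_mem_A
        (opair_mem_A emp_mem_A (opair_mem_A haA hg)), fun q hq => ?_, _, mem_adj.2 (.inr rfl),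
        fst_opair _ _⟩
      rcases mem_adj.1 hq with hq | rfl
      · exact absurd hq (not_mem_emp q)
      · refine ⟨?_, .inl ?_⟩
        · simpa using ⟨hw.1.1, (mem_height.1 ha).2, hgc⟩
        · simp
    · rintro m hm ⟨f, hf, hfc, q, hq, rfl⟩
      obtain ⟨⟨-, hb, hcov⟩, -⟩ := hfc q hq
      have hqA := Admissible.trans hf hq
      have hbA : fst (snd q) ∈ₛ A := by
        have : PR (InA A) (fun _ => q) := PR.const hqA
        exact mem_A _
      have hgA : snd (snd q) ∈ₛ A := by
        have : PR (InA A) (fun _ => q) := PR.const hqA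
        exact mem_A _
      have hnext := hcov.next_mem_height hp ha hσ (mem_height.2 ⟨hbA, hb⟩) hgA
      obtain ⟨g, hg, hgc⟩ := exists_covers hT hp ha hσ ih hnext
      have hmA := Admissible.trans hwA hm
      set q' := opair (adj (fst q) (fst q)) (opair (T.next p a σ (snd (snd q)) (fst (snd q))) g)
        with hq'
      have hsub : Subset f (adj f q') := fun t ht => mem_adj.2 (.inl ht)
      refine ⟨adj f q', adj_mem_A hf (opair_mem_A (adj_mem_A hmA hmA)
        (opair_mem_A (mem_height.1 hnext).1 hg)), fun r hr => ?_, q', mem_adj.2 (.inr rfl), ?_⟩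
      · rcases mem_adj.1 hr with hr | rfl
        · exact hfc.mono_entry hsub hr
        · refine ⟨?_, .inr ⟨q, hsub q hq, ?_⟩⟩
          · simpa [hq'] using ⟨hw.1.2 _ hm, (mem_height.1 hnext).2, hgc⟩
          · simp [hq']
      · simp [hq']
  obtain ⟨c, hc, h1, h2⟩ := pr_collection hwA
    (fun m f => T.Chain p w a σ f ∧ ∃ q, q ∈ₛ f ∧ fst q = m) key
  refine ⟨w, sU c, hw, sU_mem_A hc, Chain.sU fun f hf => ?_, fun m hm => ?_⟩
  · obtain ⟨_, _, h, -⟩ := h2 f hf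
    exact h
  · obtain ⟨f, hf, -, q, hq, h⟩ := h1 m hm
    exact ⟨q, mem_sU.2 ⟨f, hf, hq⟩, h⟩

-- The supremum of the sequence is closed: a finite support inside it is already contained in one
-- stage b_n, and the value in question is an element of stage n + 1.
include ih in
theorem exists_closed : ∃ α, α ∈ₛ height A ∧ Subset (T.spt p a σ) α ∧
    ∀ t, t ∈ₛ T.car p (height A) →
      Lt (T.ordObj p (height A)) t (T.lift p a (height A) σ) →
      Subset (T.spt p (height A) t) α → ∃ η, η ∈ₛ α ∧ T.Val p A t η := by
  obtain ⟨w, f, hw, hf, hfc, htot⟩ := exists_chain hT hp ha hσ ih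
  have hPf : PR (InA A) (fun _ => f) := PR.const hf
  have hfA : ∀ q, q ∈ₛ f → fst (snd q) ∈ₛ height A ∧ snd (snd q) ∈ₛ A := by
    intro q hq
    have : PR (InA A) (fun _ => q) := PR.const (Admissible.trans hf hq)
    exact ⟨mem_height.2 ⟨mem_A _, (hfc q hq).1.2.1⟩, mem_A _⟩
  set D := bU f fun q => upair (fst (snd q)) (fst (snd q)) with hD
  have hmem : ∀ b, b ∈ₛ D ↔ ∃ q, q ∈ₛ f ∧ fst (snd q) = b := by
    intro b
    rw [hD, mem_bU]
    simp [mem_upair, eq_comm]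
  have hDo : IsOrdSet D := fun b hb => by
    obtain ⟨q, hq, rfl⟩ := (hmem b).1 hb
    exact (hfc q hq).1.2.1
  have hDA : D ∈ₛ A := mem_A _
  obtain ⟨q₀, hq₀, hq₀'⟩ := htot emp hw.1.1
  have haD : a ∈ₛ D := by
    rcases (hfc q₀ hq₀).2 with ⟨-, h⟩ | ⟨r, -, h, -⟩
    · exact (hmem a).2 ⟨q₀, hq₀, h⟩
    · exact absurd (h.symm.trans hq₀') (adj_ne_emp _ _)
  refine ⟨sU D, mem_height.2 ⟨sU_mem_A hDA, hDo.isOrdinal_sU⟩, fun x hx => mem_sU.2 ⟨a, haD,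
    hT.1.spt_subset (mem_height.1 ha).2.isOrdSet hσ x hx⟩, fun t ht hlt hsub => ?_⟩
  obtain ⟨b, hb, hsb⟩ := (hT.1.spt_finite (isOrdSet_height A) ht).exists_subset hDo ⟨a, haD⟩ hsub
  obtain ⟨q, hq, rfl⟩ := (hmem b).1 hb
  obtain ⟨hbA, hgA⟩ := hfA q hq
  obtain ⟨⟨hqw, -, hcov⟩, -⟩ := hfc q hq
  obtain ⟨ρ, hρ, rfl⟩ := hT.1.exists_lift (isOrdSet_height A) (subset_height hbA) ht hsb
  have hlt' := (codeLt_height hT.1 hbA ha hρ hσ).2 hlt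
  obtain ⟨η, -, hη⟩ := hcov.2 ρ hρ hlt'
  have hv := hcov.1.val hgA hη
  obtain ⟨q₂, hq₂, hq₂'⟩ := htot _ (hw.1.2 _ hqw)
  refine ⟨η, mem_sU.2 ⟨_, (hmem _).2 ⟨q₂, hq₂, rfl⟩, ?_⟩, hv⟩
  rcases (hfc q₂ hq₂).2 with ⟨h, -⟩ | ⟨q₃, hq₃, h, h'⟩
  · exact absurd (hq₂'.symm.trans h) (adj_ne_emp _ _)
  -- The entry at m + 1 may refer to a predecessor `q₃` other than `q`, with a different partial
  -- collapse. Both predecessors have index m, hence the same ordinal, and `next` depends on nothing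
  -- else.
  · have e := hfc.unique hT hw hfc (fun q hq => (hfA q hq).2) (fun q hq => (hfA q hq).2) hq₃ hq (adj_self_inj (h.symm.trans hq₂'))
    have hc₃ := (hfc q₃ hq₃).1.2.2
    rw [e] at hc₃ h'
    rw [h', hc₃.mem_next hT (hfA q₃ hq₃).2]
    exact .inr ⟨ρ, η, hρ, hlt', hv, mem_adj.2 (.inr rfl)⟩

-- The least closed ordinal ξ is the value. A partial collapse witnessing this is one that covers
-- the codes over ξ below (a, σ), extended by the entry for (a, σ) itself.
include ih in
theorem exists_val : ∃ ξ, T.Val p A (T.lift p a (height A) σ) ξ := by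
  obtain ⟨α, hα, hα₁, hα₂⟩ := exists_closed hT hp ha hσ ih
  have hαo := isOrdinal_adj (mem_height.1 hα).2
  obtain ⟨ξ, hξ, ⟨hξ₁, hξ₂⟩, hmin⟩ := exists_minimal (a := adj α α) (fun ξ =>
    Subset (T.spt p a σ) ξ ∧ ∀ t, t ∈ₛ T.car p (height A) →
      Lt (T.ordObj p (height A)) t (T.lift p a (height A) σ) →
      Subset (T.spt p (height A) t) ξ → ∃ η, η ∈ₛ ξ ∧ T.Val p A t η)
    ⟨α, mem_adj.2 (.inr rfl), hα₁, hα₂⟩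
  have hξA : ξ ∈ₛ height A := by
    rcases mem_adj.1 hξ with h | rfl
    · exact subset_height hα _ h
    · exact hα
  have haA := mem_height.1 ha
  have hσA : σ ∈ₛ A := Admissible.trans (car_mem_A hp haA.1) hσ
  obtain ⟨g, hg, hgc⟩ := exists_covers hT hp ha hσ ih hξA
  refine ⟨ξ, adj g (opair (opair a σ) ξ), adj_mem_A hg (opair_mem_A (opair_mem_A haA.1 hσA)
    (mem_height.1 hξA).1), hgc.1.adj haA.2 hσ (mem_height.1 hξA).2
    ⟨hξ₁, fun ρ hρ hlt => ?_, fun ζ hζ hsub => ?_⟩, a, ha, σ, hσ, rfl, mem_adj.2 (.inr rfl)⟩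
  · obtain ⟨η, hη, hv⟩ := hξ₂ _ (lift_mem_height hT.1 hξA hρ)
      ((codeLt_height hT.1 hξA ha hρ hσ).1 hlt)
      ((spt_lift_height hT.1 hξA hρ).symm ▸ hT.1.spt_subset (mem_height.1 hξA).2.isOrdSet hρ)
    exact ⟨η, hη, (hgc.mem_iff hT hg hρ hlt).2 hv⟩
  -- Since ζ < ξ is not closed, some t < s with support in ζ has no value in ζ. Closure of ξ
  -- provides a value of t in ξ, which is the witness demanded by the minimality clause.
  · have h := hmin ζ (hαo.1 ξ hξ ζ hζ) hζ
    simp only [hsub, true_and, not_forall] at h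
    obtain ⟨t, ht, hlt, hst, hη⟩ := h
    have hstξ := hst.trans ((mem_height.1 hξA).2.1 ζ hζ)
    obtain ⟨η, hηξ, hv⟩ := hξ₂ t ht hlt hstξ
    obtain ⟨ρ, hρ, rfl⟩ := hT.1.exists_lift (isOrdSet_height A) (subset_height hξA) ht hstξ
    rw [spt_lift_height hT.1 hξA hρ] at hst
    have hlt' := (codeLt_height hT.1 hξA ha hρ hσ).2 hlt
    exact ⟨ρ, hρ, hst, hlt', η, hηξ, (hgc.mem_iff hT hg hρ hlt').2 hv,
      fun hηζ => hη ⟨η, hηζ, hv⟩⟩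

end Existence

theorem exists_val_of_mem_car (hT : T.IsDilator p) (hp : p ∈ₛ A) :
    ∀ s, s ∈ₛ T.car p (height A) → ∃ ξ, ξ ∈ₛ A ∧ T.Val p A s ξ := by
  refine car_induction hT (fun s => ∃ ξ, ξ ∈ₛ A ∧ T.Val p A s ξ) fun s hs ih => ?_
  have hsub := hT.1.spt_subset (isOrdSet_height A) hs
  have hne : ∃ d, d ∈ₛ height A := ⟨emp, mem_height.2 ⟨emp_mem_A,
    fun y hy => absurd hy (not_mem_emp y), fun y hy => absurd hy (not_mem_emp y)⟩⟩
  obtain ⟨a, ha, hsa⟩ := (hT.1.spt_finite (isOrdSet_height A) hs).exists_subset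
    (isOrdSet_height A) hne (hsub.trans subset_sU_height)
  obtain ⟨σ, hσ, rfl⟩ := hT.1.exists_lift (isOrdSet_height A) (subset_height ha) hs hsa
  obtain ⟨ξ, hξ⟩ := exists_val hT hp ha hσ fun t ht hlt => (ih t ht hlt).imp fun ξ h => h.2
  exact ⟨ξ, (mem_height.1 hξ.mem_height).1, hξ⟩

/-- The height of an admissible set is a Bachmann-Howard fixed point. -/
theorem isBHFixedPoint_height (hT : T.IsDilator p) (hp : p ∈ₛ A) :
    T.IsBHFixedPoint p (ordX (height A)) := by
  have ho := isOrdSet_height A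
  have hobj : T.objAt p (ordX (height A)) = T.ordObj p (height A) := rfl
  set θ := bU (T.car p (height A)) fun s => bU (height A) fun ξ =>
    cset (T.Val p A s ξ) (upair (opair s ξ) (opair s ξ)) emp with hθ
  have hmem : ∀ q, q ∈ₛ θ ↔ ∃ s ξ, T.Val p A s ξ ∧ q = opair s ξ := by
    intro q
    simp only [hθ, mem_bU (fun _ => bU _ _), mem_bU (fun _ => cset _ _ _), mem_cset, mem_upair,
      not_mem_emp, and_false, or_false, or_self]
    constructor
    · rintro ⟨s, -, ξ, -, h⟩; exact ⟨s, ξ, h⟩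
    · rintro ⟨s, ξ, h, e⟩; exact ⟨s, h.car hT.1, ξ, h.mem_height, h, e⟩
  have hmem' : ∀ s ξ, opair s ξ ∈ₛ θ ↔ T.Val p A s ξ := by
    intro s ξ
    rw [hmem]
    constructor
    · rintro ⟨s', ξ', h, e⟩
      obtain ⟨rfl, rfl⟩ := opair_inj e
      exact h
    · exact fun h => ⟨s, ξ, h, rfl⟩
  refine ⟨ho.isLinearOrder, θ, ⟨T.car p (height A), _, height A, memRel (height A),
    (hT.1.ordObj_linear ho).eq_opair, rfl, fun q hq => ?_, fun s hs => ?_⟩, ?_, ?_⟩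
  · obtain ⟨s, ξ, h, rfl⟩ := (hmem q).1 hq
    exact ⟨s, ξ, h.car hT.1, h.mem_height, rfl⟩
  · obtain ⟨ξ, -, hξ⟩ := exists_val_of_mem_car hT hp s hs
    exact ⟨ξ, (hmem' s ξ).2 hξ, fun ξ' h' => ((hmem' s ξ').1 h').unique hT hξ⟩
  · intro s t α β hs ht hlt hsub
    rw [hmem'] at hs ht
    -- Condition (i): the support hypothesis places supp(s) inside β, the value of t, so closure of
    -- β puts the unique value of s into β. Condition (ii) is the support clause of `Step`.
    obtain ⟨η, hη, hv⟩ := ht.exists_below hT.1 (hs.car hT.1) hlt fun x hx => (lt_ordX.1 (hsub x hx)).2.2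
    rw [lt_ordX, hs.unique hT hv]
    exact ⟨hv.mem_height, ht.mem_height, hη⟩
  · intro s α hs x hx
    rw [hmem'] at hs
    have hxα := hs.spt_subset hT.1 x hx
    exact lt_ordX.2 ⟨subset_height hs.mem_height x hxα, hs.mem_height, hxα⟩

end DilatorCode

theorem isHeightOrder_height {M : Type u} [PRSetModel M] (A : M) :
    IsHeightOrder (ordX (height A)) A :=
  ⟨height A, memRel (height A), rfl, fun _ => mem_height, fun _ => mem_memRel⟩

end BachmannHoward

theorem mainTheorem2 (M : Type u) [BachmannHoward.ATR0SetModel M] :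
    (∀ (T : BachmannHoward.DilatorCode) (p A : M), T.IsDilator p →
      BachmannHoward.IsAdmissible A → BachmannHoward.PRSetModel.mem p A →
      ∃ X : M, BachmannHoward.IsHeightOrder X A ∧ BachmannHoward.IsWellOrder X ∧
        T.IsBHFixedPoint p X) ∧
    ((∀ x : M, ∃ A : M, BachmannHoward.IsAdmissible A ∧ BachmannHoward.PRSetModel.mem x A) →
      ∀ (T : BachmannHoward.DilatorCode) (p : M), T.IsDilator p →
        ∃ X : M, BachmannHoward.IsWellOrder X ∧ T.IsBHFixedPoint p X) := by
  have key : ∀ (T : BachmannHoward.DilatorCode) (p A : M), T.IsDilator p →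
      BachmannHoward.IsAdmissible A → BachmannHoward.PRSetModel.mem p A →
      ∃ X : M, BachmannHoward.IsHeightOrder X A ∧ BachmannHoward.IsWellOrder X ∧
        T.IsBHFixedPoint p X := by
    intro T p A hT hA hp
    have : BachmannHoward.Admissible A := ⟨hA⟩
    exact ⟨_, BachmannHoward.isHeightOrder_height A,
      (BachmannHoward.isOrdSet_height A).isWellOrder,
      BachmannHoward.DilatorCode.isBHFixedPoint_height hT hp⟩
  refine ⟨key, fun h T p hT => ?_⟩
  obtain ⟨A, hA, hp⟩ := h p
  obtain ⟨X, -, hX⟩ := key T p A hT hA hp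
  exact ⟨X, hX⟩
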